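/- \textbf{Setting.} Let $E\dot x=Ax$, $y_i=C_ix$ ($i=1,\dots,N$), with $E,A\in\mathbb R^{n\times n}$ and $C_i\in\mathbb R^{p_i\times n}$, be a regular descriptor system ($\det(cE-A)\neq0$ for some $c$), and put $C=\mathrm{col}\{C_1,\dots,C_N\}$. Let $Q,P$ be nonsingular with $$QEP=\mathrm{diag}\{I_l,0\},\qquad QAP=\begin{bmatrix}A_{11}&A_{12}\\A_{21}&A_{22}\end{bmatrix},\qquad C_iP=[C_{i1},\,C_{i2}],$$ and let $\mathcal G$ be a strongly connected directed graph on $\{1,\dots,N\}$, with $\alpha_{ij}=1$ if there is an arc from $j$ to $i$ and $\alpha_{ij}=0$ otherwise, and with Laplacian $\mathcal L=\mathrm{diag}\{\sum_j\alpha_{ij}\}-[\alpha_{ij}]$. Assume that the pairs $(\mathrm{col}\{C_{11},\dots,C_{N1}\},A_{11})$ and $(\mathrm{col}\{C_{12},\dots,C_{N2}\},A_{22})$ are observable. For $k=1,2$ and every $i$ let $T_{ik}$ be orthogonal with $$T_{ik}^\top A_{kk}T_{ik}=\begin{bmatrix}A_{kk,io}&0\\A_{kk,ir}&A_{kk,iu}\end{bmatrix},\qquad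 C_{ik}T_{ik}=[C_{iko},\,0],$$ where $(C_{iko},A_{kk,io})$ is observable, of dimension $v_{ik}$. Write $\mathrm{sym}\{M\}=M+M^\top$, $T_k=\mathrm{diag}\{T_{1k},\dots,T_{Nk}\}$, $n_1=l$, $n_2=n-l$. \textbf{Theorem.} There are $r_1,\dots,r_N>0$ with $r^\top\mathcal L=0$ and $\sum_ir_i=N$. Put $R=\mathrm{diag}\{r_1,\dots,r_N\}$, $\hat{\mathcal L}=R\mathcal L+\mathcal L^\top R$ and $G_k=\mathrm{diag}\{r_i\,\mathrm{diag}\{I_{v_{ik}},0\},\ i=1,\dots,N\}$. There is $\mu>0$ such that $$T_k^\top(\hat{\mathcal L}\otimes I_{n_k})T_k+G_k>\mu I\qquad(k=1,2).\tag{1}$$ Let $\mu>0$ be any number satisfying (1), let $\gamma>0$, and choose the parameters of the distributed observer $$E\dot{\hat x}_i=A\hat x_i+H_i(y_i-C_i\hat x_i)+\gamma W_i^{-1}\sum_{j=1}^N\alpha_{ij}(\hat x_j-\hat x_i),\qquad i=1,\dots,N,$$ as follows. 1) $H_i=Q^{-1}\mathrm{col}\{H_{i1},H_{i2}\}$ with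 $H_{ik}=T_{ik}\,\mathrm{col}\{H_{iko},0\}$, where $A_{kk,io}-H_{iko}C_{iko}$ is Hurwitz for $k=1,2$. 2) $W_i=P\,\mathrm{diag}\{T_{i1}\tilde W_{i1}T_{i1}^\top,\ T_{i2}\tilde W_{i2}T_{i2}^\top\}\,Q$ with $\tilde W_{ik}=\mathrm{diag}\{\tilde W_{iko},I_{n_k-v_{ik}}\}$, where $\tilde W_{iko}$ is symmetric positive definite and $\mathrm{sym}\{\tilde W_{iko}(A_{kk,io}-H_{iko}C_{iko})\}=-2\gamma I_{v_{ik}}$ for $k=1,2$. 3) $\gamma>\frac1\mu\max\{\lambda_1,\lambda_2\}$. Here, with $\Lambda_{kku}=\mathrm{diag}\left\{r_i\begin{bmatrix}0&0\\A_{kk,ir}&A_{kk,iu}\end{bmatrix},\ i=1,\dots,N\right\}$, $\lambda_1$ is the largest singular value of $\Lambda_{22u}+\Lambda_{22u}^\top$, and $\lambda_2$ is the largest eigenvalue of $$\Lambda_{11u}+\Lambda_{11u}^\top-\mathrm{sym}\{X_{11}\tilde\Lambda_{12}\tilde\Lambda_{22}^{-1}\tilde\Lambda_{21}\},$$ where $X_{11}=\mathrm{diag}\{r_i\tilde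 W_{i1}\}$, $\tilde\Lambda_{12}=T_1^\top\mathrm{diag}\{A_{12}-H_{i1}C_{i2}\}T_2$, $\tilde\Lambda_{21}=T_2^\top\mathrm{diag}\{A_{21}-H_{i2}C_{i1}\}T_1$ and $\tilde\Lambda_{22}=T_2^\top\mathrm{diag}\{A_{22}-H_{i2}C_{i2}\}T_2-\gamma\,\mathrm{diag}\{\tilde W_{i2}^{-1}\}T_2^\top(\mathcal L\otimes I_{n-l})T_2$. (The number $\lambda_2$ depends on $\gamma$; the extreme eigenvalue or singular value of an empty matrix is read as $0$.) Then the observer achieves omniscience asymptotically: $\lim_{t\to\infty}\|\hat x_i(t)-x(t)\|=0$ for every $i$ and all trajectories $x$ of the system and $\hat x_1,\dots,\hat x_N$ of the observer. Moreover, the error dynamics of $\mathrm{col}\{\hat x_1-x,\dots,\hat x_N-x\}$, $$(I_N\otimes E)\dot e=\left(\mathrm{diag}\{A-H_iC_i\}-\gamma\,\mathrm{diag}\{W_i^{-1}\}(\mathcal L\otimes I_n)\right)e,$$ is admissible, i.e. it is impulse-free (the lower right block of its right-hand side matrix in a dynamic decomposition form is invertible) and all its trajectories converge to $0$. -/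

import Mathlib

open Filter Topology
open scoped Matrix

namespace DistObs

noncomputable section

/-! ### Linear algebra and linear systems -/

/-- A real square matrix is Hurwitz: all its complex eigenvalues have negative real part. -/
def IsHurwitz {ι : Type*} [Fintype ι] [DecidableEq ι] (M : Matrix ι ι ℝ) : Prop :=
  ∀ z ∈ spectrum ℂ (M.map (algebraMap ℝ ℂ)), z.re < 0

/-- The pair `(C, A)` is observable: its unobservable subspace `⋂ₖ ker (C A ^ k)` is zero. -/
def IsObservablePair {ι κ : Type*} [Fintype ι] [DecidableEq ι]
    (C : Matrix κ ι ℝ) (A : Matrix ι ι ℝ) : Prop :=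
  ∀ x : ι → ℝ, (∀ k : ℕ, (C * A ^ k) *ᵥ x = 0) → x = 0

/-- The largest singular value of a real square matrix (its operator norm for the Euclidean
norm; `0` for the empty matrix). -/
def sigmaMax {ι : Type*} [Fintype ι] [DecidableEq ι] (M : Matrix ι ι ℝ) : ℝ :=
  ‖Matrix.toEuclideanCLM (n := ι) (𝕜 := ℝ) M‖

/-- The largest real eigenvalue of a real square matrix; it is used for symmetric matrices
(it is `0` for the empty matrix). -/
def eigMax {ι : Type*} [Fintype ι] [DecidableEq ι] (M : Matrix ι ι ℝ) : ℝ :=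
  sSup (spectrum ℝ M)

/-- `z` is a trajectory of the descriptor system `E ż = A z` for positive times. Only `E z` has
to be differentiable, and nothing is required at the initial time, so that jumps there
(inconsistent initial states) are allowed. -/
def IsTrajectory {ι : Type*} [Fintype ι] (E A : Matrix ι ι ℝ) (z : ℝ → ι → ℝ) : Prop :=
  ∀ t : ℝ, 0 < t → HasDerivAt (fun s => E *ᵥ z s) (A *ᵥ z t) t

/-- `E ż = A z` is impulse-free: it has a dynamic decomposition form
`Q E P = diag {I, 0}`, `Q A P = [A₁₁ A₁₂; A₂₁ A₂₂]` with `Q`, `P` nonsingular, in which `A₂₂`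
is invertible. (Whether `A₂₂` is invertible does not depend on the choice of the form.) -/
def ImpulseFree {ι : Type*} [Fintype ι] [DecidableEq ι] (E A : Matrix ι ι ℝ) : Prop :=
  ∃ (r s : ℕ) (e : ι ≃ Fin r ⊕ Fin s) (Q P : Matrix ι ι ℝ),
    IsUnit Q ∧ IsUnit P ∧
    (Q * E * P).reindex e e = Matrix.fromBlocks 1 0 0 0 ∧
    IsUnit ((Q * A * P).reindex e e).toBlocks₂₂

/-- `E ż = A z` is admissible: it is impulse-free and its state converges to zero. -/
structure Admissible {ι : Type*} [Fintype ι] [DecidableEq ι] (E A : Matrix ι ι ℝ) : Prop where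
  impulseFree : ImpulseFree E A
  tendsto_zero : ∀ z : ℝ → ι → ℝ, IsTrajectory E A z → Tendsto z atTop (𝓝 0)

/-! ### The communication network -/

open scoped Classical in
/-- The adjacency matrix `[α i j]` of the network: `α i j = 1` if there is an arc from `j` to
`i`, and `0` otherwise. -/
def adj {N : ℕ} (G : Digraph (Fin N)) : Matrix (Fin N) (Fin N) ℝ :=
  Matrix.of fun i j => if G.Adj j i then 1 else 0

/-- The graph Laplacian: in-degree matrix minus adjacency matrix. -/
def lap {N : ℕ} (G : Digraph (Fin N)) : Matrix (Fin N) (Fin N) ℝ :=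
  Matrix.diagonal (fun i => ∑ j, adj G i j) - adj G

/-- Any node can be reached from any other one along a directed path. -/
def StronglyConnected {N : ℕ} (G : Digraph (Fin N)) : Prop :=
  ∀ i j : Fin N, Relation.ReflTransGen G.Adj i j

/-- `r` is the positive left null vector of the Laplacian, normalised by `∑ i, r i = N`. -/
structure IsLeftVector {N : ℕ} (G : Digraph (Fin N)) (r : Fin N → ℝ) : Prop where
  pos : ∀ i, 0 < r i
  left_null : r ᵥ* lap G = 0
  sum_eq : ∑ i, r i = N

/-- The symmetrised Laplacian `R L + Lᵀ R` with `R = diag r`. -/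
def symLap {N : ℕ} (G : Digraph (Fin N)) (r : Fin N → ℝ) : Matrix (Fin N) (Fin N) ℝ :=
  Matrix.diagonal r * lap G + (lap G)ᵀ * Matrix.diagonal r

/-- The Kronecker product `M ⊗ I`, acting on stacked vectors `col {x₁, …, x_N}`. -/
def kronOne {N : ℕ} (M : Matrix (Fin N) (Fin N) ℝ) (κ : Type*) [DecidableEq κ] :
    Matrix (Σ _ : Fin N, κ) (Σ _ : Fin N, κ) ℝ :=
  Matrix.of fun a b => M a.1 b.1 * (1 : Matrix κ κ ℝ) a.2 b.2

/-- The block column `col {C₁, …, C_N}`. -/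
def stackRows {N : ℕ} {p : Fin N → ℕ} {κ : Type*} (C : ∀ i, Matrix (Fin (p i)) κ ℝ) :
    Matrix (Σ i, Fin (p i)) κ ℝ :=
  Matrix.of fun a k => C a.1 a.2 k

/-! ### The descriptor system and its decompositions -/

/-- A regular descriptor system `E ẋ = A x`, `yᵢ = Cᵢ x` (`i = 1, …, N`) with state space of
dimension `n = l + m`, the coordinates being indexed by `Fin l ⊕ Fin m`. -/
structure DescriptorSystem (N l m : ℕ) (p : Fin N → ℕ) where
  E : Matrix (Fin l ⊕ Fin m) (Fin l ⊕ Fin m) ℝ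
  A : Matrix (Fin l ⊕ Fin m) (Fin l ⊕ Fin m) ℝ
  C : ∀ i, Matrix (Fin (p i)) (Fin l ⊕ Fin m) ℝ
  regular : ∃ c : ℝ, (c • E - A).det ≠ 0

/-- A dynamic decomposition form of a descriptor system. -/
structure DDF {N l m : ℕ} {p : Fin N → ℕ} (S : DescriptorSystem N l m p) where
  Q : Matrix (Fin l ⊕ Fin m) (Fin l ⊕ Fin m) ℝ
  P : Matrix (Fin l ⊕ Fin m) (Fin l ⊕ Fin m) ℝ
  A11 : Matrix (Fin l) (Fin l) ℝ
  A12 : Matrix (Fin l) (Fin m) ℝ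
  A21 : Matrix (Fin m) (Fin l) ℝ
  A22 : Matrix (Fin m) (Fin m) ℝ
  C1 : ∀ i, Matrix (Fin (p i)) (Fin l) ℝ
  C2 : ∀ i, Matrix (Fin (p i)) (Fin m) ℝ
  isUnit_Q : IsUnit Q
  isUnit_P : IsUnit P
  QEP : Q * S.E * P = Matrix.fromBlocks 1 0 0 0
  QAP : Q * S.A * P = Matrix.fromBlocks A11 A12 A21 A22
  CP : ∀ i, S.C i * P = Matrix.fromCols (C1 i) (C2 i)

/-- An orthogonal observability decomposition of the pair `(C, A)`:
`Tᵀ A T = [Ao 0; Ar Au]` and `C T = [Co 0]` with `(Co, Ao)` observable of size `v`. -/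
structure ObsDecomp {q k : ℕ} (C : Matrix (Fin q) (Fin k) ℝ) (A : Matrix (Fin k) (Fin k) ℝ) where
  v : ℕ
  u : ℕ
  T : Matrix (Fin k) (Fin v ⊕ Fin u) ℝ
  Ao : Matrix (Fin v) (Fin v) ℝ
  Ar : Matrix (Fin u) (Fin v) ℝ
  Au : Matrix (Fin u) (Fin u) ℝ
  Co : Matrix (Fin q) (Fin v) ℝ
  transpose_mul_self : Tᵀ * T = 1
  mul_transpose_self : T * Tᵀ = 1
  TAT : Tᵀ * A * T = Matrix.fromBlocks Ao 0 Ar Au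
  CT : C * T = Matrix.fromCols Co 0
  observable : IsObservablePair Co Ao

/-! ### Block diagonal matrices built from a family of observability decompositions -/

section Family

variable {N k : ℕ} {p : Fin N → ℕ} {C : ∀ i, Matrix (Fin (p i)) (Fin k) ℝ}
  {A : Matrix (Fin k) (Fin k) ℝ}

/-- `diag {T₁, …, T_N}`. -/
def bigT (D : ∀ i, ObsDecomp (C i) A) :
    Matrix (Σ _ : Fin N, Fin k) (Σ i, Fin (D i).v ⊕ Fin (D i).u) ℝ :=
  Matrix.blockDiagonal' fun i => (D i).T

/-- `diag {g₁ diag {I, 0}, …, g_N diag {I, 0}}`, the identity blocks having the sizes of the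
locally observable parts. -/
def bigG (D : ∀ i, ObsDecomp (C i) A) (g : Fin N → ℝ) :
    Matrix (Σ i, Fin (D i).v ⊕ Fin (D i).u) (Σ i, Fin (D i).v ⊕ Fin (D i).u) ℝ :=
  Matrix.blockDiagonal' fun i => g i • Matrix.fromBlocks 1 0 0 0

/-- `diag {rᵢ [0 0; Arᵢ Auᵢ]}`. -/
def bigU (D : ∀ i, ObsDecomp (C i) A) (r : Fin N → ℝ) :
    Matrix (Σ i, Fin (D i).v ⊕ Fin (D i).u) (Σ i, Fin (D i).v ⊕ Fin (D i).u) ℝ :=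
  Matrix.blockDiagonal' fun i => r i • Matrix.fromBlocks 0 0 (D i).Ar (D i).Au

/-- `W̃ᵢ = diag {Wo, I}`, the identity acting on the locally unobservable part. -/
def weightTilde (D : ∀ i, ObsDecomp (C i) A) (Wo : ∀ i, Matrix (Fin (D i).v) (Fin (D i).v) ℝ)
    (i : Fin N) : Matrix (Fin (D i).v ⊕ Fin (D i).u) (Fin (D i).v ⊕ Fin (D i).u) ℝ :=
  Matrix.fromBlocks (Wo i) 0 0 1

/-- `Tᵢ W̃ᵢ Tᵢᵀ`. -/
def weightT (D : ∀ i, ObsDecomp (C i) A) (Wo : ∀ i, Matrix (Fin (D i).v) (Fin (D i).v) ℝ)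
    (i : Fin N) : Matrix (Fin k) (Fin k) ℝ :=
  (D i).T * weightTilde D Wo i * (D i).Tᵀ

/-- `Tᵢ col {Ho, 0}`. -/
def gainT (D : ∀ i, ObsDecomp (C i) A) (Ho : ∀ i, Matrix (Fin (D i).v) (Fin (p i)) ℝ)
    (i : Fin N) : Matrix (Fin k) (Fin (p i)) ℝ :=
  (D i).T * Matrix.fromRows (Ho i) 0

/-- `μ` is a joint observability bound: `Tᵀ ((R L + Lᵀ R) ⊗ I) T + G > μ I` with `gᵢ = rᵢ`. -/
def JointBound (G : Digraph (Fin N)) (r : Fin N → ℝ) (D : ∀ i, ObsDecomp (C i) A) (μ : ℝ) :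
    Prop :=
  ((bigT D)ᵀ * kronOne (symLap G r) (Fin k) * bigT D + bigG D r - μ • 1).PosDef

/-- The conditions on the observable blocks: `Aoᵢ - Hoᵢ Coᵢ` is Hurwitz, and `Woᵢ` is a symmetric
positive definite solution of `sym {Woᵢ (Aoᵢ - Hoᵢ Coᵢ)} = - 2 γ I`, where `sym M = M + Mᵀ`. -/
structure LocalDesign (D : ∀ i, ObsDecomp (C i) A) (Ho : ∀ i, Matrix (Fin (D i).v) (Fin (p i)) ℝ)
    (Wo : ∀ i, Matrix (Fin (D i).v) (Fin (D i).v) ℝ) (γ : ℝ) : Prop where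
  hurwitz : ∀ i, IsHurwitz ((D i).Ao - Ho i * (D i).Co)
  posDef : ∀ i, (Wo i).PosDef
  lyapunov : ∀ i, Wo i * ((D i).Ao - Ho i * (D i).Co) +
    (Wo i * ((D i).Ao - Ho i * (D i).Co))ᵀ = -(2 * γ) • (1 : Matrix (Fin (D i).v) (Fin (D i).v) ℝ)

end Family

/-! ### The distributed observer -/

section Observer

variable {N l m : ℕ} {p : Fin N → ℕ} {S : DescriptorSystem N l m p}

/-- The observer gains `Hᵢ = Q⁻¹ col {Hᵢ₁, Hᵢ₂}`. -/
def gainH (F : DDF S) (D1 : ∀ i, ObsDecomp (F.C1 i) F.A11) (D2 : ∀ i, ObsDecomp (F.C2 i) F.A22)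
    (Ho1 : ∀ i, Matrix (Fin (D1 i).v) (Fin (p i)) ℝ)
    (Ho2 : ∀ i, Matrix (Fin (D2 i).v) (Fin (p i)) ℝ) (i : Fin N) :
    Matrix (Fin l ⊕ Fin m) (Fin (p i)) ℝ :=
  F.Q⁻¹ * Matrix.fromRows (gainT D1 Ho1 i) (gainT D2 Ho2 i)

/-- The weight matrices `Wᵢ = P diag {Wᵢ₁, Wᵢ₂} Q`. -/
def weightW (F : DDF S) (D1 : ∀ i, ObsDecomp (F.C1 i) F.A11) (D2 : ∀ i, ObsDecomp (F.C2 i) F.A22)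
    (Wo1 : ∀ i, Matrix (Fin (D1 i).v) (Fin (D1 i).v) ℝ)
    (Wo2 : ∀ i, Matrix (Fin (D2 i).v) (Fin (D2 i).v) ℝ) (i : Fin N) :
    Matrix (Fin l ⊕ Fin m) (Fin l ⊕ Fin m) ℝ :=
  F.P * Matrix.fromBlocks (weightT D1 Wo1 i) 0 0 (weightT D2 Wo2 i) * F.Q

/-- `x̂ = (x̂₁, …, x̂_N)` is a trajectory of the distributed observer
`E ẋ̂ᵢ = A x̂ᵢ + Hᵢ (yᵢ - Cᵢ x̂ᵢ) + γ Wᵢ⁻¹ ∑ⱼ αᵢⱼ (x̂ⱼ - x̂ᵢ)` driven by the outputs `yᵢ = Cᵢ x`. -/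
def IsObserverTrajectory (S : DescriptorSystem N l m p) (G : Digraph (Fin N))
    (H : ∀ i, Matrix (Fin l ⊕ Fin m) (Fin (p i)) ℝ)
    (W : Fin N → Matrix (Fin l ⊕ Fin m) (Fin l ⊕ Fin m) ℝ) (γ : ℝ)
    (x : ℝ → Fin l ⊕ Fin m → ℝ) (xhat : Fin N → ℝ → Fin l ⊕ Fin m → ℝ) : Prop :=
  ∀ (i : Fin N) (t : ℝ), 0 < t →
    HasDerivAt (fun s => S.E *ᵥ xhat i s)
      (S.A *ᵥ xhat i t + H i *ᵥ (S.C i *ᵥ x t - S.C i *ᵥ xhat i t) +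
        γ • ((W i)⁻¹ *ᵥ ∑ j, adj G i j • (xhat j t - xhat i t))) t

/-- The distributed observer achieves omniscience asymptotically: for all trajectories of the
system and of the observer, every estimate `x̂ᵢ` converges to the state `x`. -/
def Omniscience (S : DescriptorSystem N l m p) (G : Digraph (Fin N))
    (H : ∀ i, Matrix (Fin l ⊕ Fin m) (Fin (p i)) ℝ)
    (W : Fin N → Matrix (Fin l ⊕ Fin m) (Fin l ⊕ Fin m) ℝ) (γ : ℝ) : Prop :=
  ∀ (x : ℝ → Fin l ⊕ Fin m → ℝ) (xhat : Fin N → ℝ → Fin l ⊕ Fin m → ℝ),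
    IsTrajectory S.E S.A x → IsObserverTrajectory S G H W γ x xhat →
      ∀ i, Tendsto (fun t => ‖xhat i t - x t‖) atTop (𝓝 0)

/-- The left-hand side `I_N ⊗ E` of the error dynamics, for the stacked error
`e = col {x̂₁ - x, …, x̂_N - x}`. -/
def errorE (S : DescriptorSystem N l m p) :
    Matrix (Σ _ : Fin N, Fin l ⊕ Fin m) (Σ _ : Fin N, Fin l ⊕ Fin m) ℝ :=
  Matrix.blockDiagonal' fun _ => S.E

/-- The right-hand side `diag {A - Hᵢ Cᵢ} - γ diag {Wᵢ⁻¹} (L ⊗ I)` of the error dynamics. -/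
def errorA (S : DescriptorSystem N l m p) (G : Digraph (Fin N))
    (H : ∀ i, Matrix (Fin l ⊕ Fin m) (Fin (p i)) ℝ)
    (W : Fin N → Matrix (Fin l ⊕ Fin m) (Fin l ⊕ Fin m) ℝ) (γ : ℝ) :
    Matrix (Σ _ : Fin N, Fin l ⊕ Fin m) (Σ _ : Fin N, Fin l ⊕ Fin m) ℝ :=
  (Matrix.blockDiagonal' fun i => S.A - H i * S.C i) -
    γ • ((Matrix.blockDiagonal' fun i => (W i)⁻¹) * kronOne (lap G) (Fin l ⊕ Fin m))

/-! ### The constants of the coupling condition -/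

/-- `λ₁`, the largest singular value of `Λ₂₂ᵤ + Λ₂₂ᵤᵀ` with
`Λ₂₂ᵤ = diag {rᵢ [0 0; A₂₂,ᵢᵣ A₂₂,ᵢᵤ]}`. -/
def lambda1 (F : DDF S) (r : Fin N → ℝ) (D2 : ∀ i, ObsDecomp (F.C2 i) F.A22) : ℝ :=
  sigmaMax (bigU D2 r + (bigU D2 r)ᵀ)

/-- `Λ̃₁₂ = T₁ᵀ diag {A₁₂ - Hᵢ₁ Cᵢ₂} T₂`. -/
def Lam12 (F : DDF S) (D1 : ∀ i, ObsDecomp (F.C1 i) F.A11) (D2 : ∀ i, ObsDecomp (F.C2 i) F.A22)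
    (Ho1 : ∀ i, Matrix (Fin (D1 i).v) (Fin (p i)) ℝ) :
    Matrix (Σ i, Fin (D1 i).v ⊕ Fin (D1 i).u) (Σ i, Fin (D2 i).v ⊕ Fin (D2 i).u) ℝ :=
  (bigT D1)ᵀ * (Matrix.blockDiagonal' fun i => F.A12 - gainT D1 Ho1 i * F.C2 i) * bigT D2

/-- `Λ̃₂₁ = T₂ᵀ diag {A₂₁ - Hᵢ₂ Cᵢ₁} T₁`. -/
def Lam21 (F : DDF S) (D1 : ∀ i, ObsDecomp (F.C1 i) F.A11) (D2 : ∀ i, ObsDecomp (F.C2 i) F.A22)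
    (Ho2 : ∀ i, Matrix (Fin (D2 i).v) (Fin (p i)) ℝ) :
    Matrix (Σ i, Fin (D2 i).v ⊕ Fin (D2 i).u) (Σ i, Fin (D1 i).v ⊕ Fin (D1 i).u) ℝ :=
  (bigT D2)ᵀ * (Matrix.blockDiagonal' fun i => F.A21 - gainT D2 Ho2 i * F.C1 i) * bigT D1

/-- `Λ̃₂₂ = T₂ᵀ diag {A₂₂ - Hᵢ₂ Cᵢ₂} T₂ - γ W̃₂⁻¹ T₂ᵀ (L ⊗ I) T₂`. -/
def Lam22 (F : DDF S) (G : Digraph (Fin N)) (D2 : ∀ i, ObsDecomp (F.C2 i) F.A22)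
    (Ho2 : ∀ i, Matrix (Fin (D2 i).v) (Fin (p i)) ℝ)
    (Wo2 : ∀ i, Matrix (Fin (D2 i).v) (Fin (D2 i).v) ℝ) (γ : ℝ) :
    Matrix (Σ i, Fin (D2 i).v ⊕ Fin (D2 i).u) (Σ i, Fin (D2 i).v ⊕ Fin (D2 i).u) ℝ :=
  (bigT D2)ᵀ * (Matrix.blockDiagonal' fun i => F.A22 - gainT D2 Ho2 i * F.C2 i) * bigT D2 -
    γ • ((Matrix.blockDiagonal' fun i => (weightTilde D2 Wo2 i)⁻¹) *
      ((bigT D2)ᵀ * kronOne (lap G) (Fin m) * bigT D2))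

/-- `X₁₁ = (R ⊗ I) W̃₁ = diag {rᵢ W̃ᵢ₁}`. -/
def X11 (F : DDF S) (r : Fin N → ℝ) (D1 : ∀ i, ObsDecomp (F.C1 i) F.A11)
    (Wo1 : ∀ i, Matrix (Fin (D1 i).v) (Fin (D1 i).v) ℝ) :
    Matrix (Σ i, Fin (D1 i).v ⊕ Fin (D1 i).u) (Σ i, Fin (D1 i).v ⊕ Fin (D1 i).u) ℝ :=
  Matrix.blockDiagonal' fun i => r i • weightTilde D1 Wo1 i

/-- `λ₂`, the largest eigenvalue of the symmetric matrix
`Λ₁₁ᵤ + Λ₁₁ᵤᵀ - X₁₁ Λ̃₁₂ Λ̃₂₂⁻¹ Λ̃₂₁ - (X₁₁ Λ̃₁₂ Λ̃₂₂⁻¹ Λ̃₂₁)ᵀ` with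
`Λ₁₁ᵤ = diag {rᵢ [0 0; A₁₁,ᵢᵣ A₁₁,ᵢᵤ]}`. -/
def lambda2 (F : DDF S) (G : Digraph (Fin N)) (r : Fin N → ℝ)
    (D1 : ∀ i, ObsDecomp (F.C1 i) F.A11) (D2 : ∀ i, ObsDecomp (F.C2 i) F.A22)
    (Ho1 : ∀ i, Matrix (Fin (D1 i).v) (Fin (p i)) ℝ)
    (Ho2 : ∀ i, Matrix (Fin (D2 i).v) (Fin (p i)) ℝ)
    (Wo1 : ∀ i, Matrix (Fin (D1 i).v) (Fin (D1 i).v) ℝ)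
    (Wo2 : ∀ i, Matrix (Fin (D2 i).v) (Fin (D2 i).v) ℝ) (γ : ℝ) : ℝ :=
  let K := X11 F r D1 Wo1 * Lam12 F D1 D2 Ho1 * (Lam22 F G D2 Ho2 Wo2 γ)⁻¹ * Lam21 F D1 D2 Ho2
  eigMax (bigU D1 r + (bigU D1 r)ᵀ - K - Kᵀ)

end Observer

end

end DistObs

/-! In the coordinates of the decomposition form the stacked error splits into a differential part
(k = 1) and an algebraic part (k = 2). The weights are built so that the coupling never mixes the
two. In observability coordinates each diagonal block `errorBlock` has the Lyapunov matrix `X = diag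
{rᵢ W̃ᵢ}`: it cancels the weights in front of the Laplacian, and the Lyapunov equations turn the
observable blocks into multiples of `I`, so that `sym (X * errorBlock) = U + Uᵀ - 2γ G - γ Tᵀ(L̂ ⊗
I)T`, where `U` collects the unobservable parts. By the joint bound (1) this is at most `U + Uᵀ - γμ
I`, which is negative definite once `γμ` dominates `U + Uᵀ` (`LocalDesign.posDef_neg_sym`).

For k = 2, the condition on `λ₁` makes the algebraic block invertible, which is impulse-freeness.
The algebraic error can then be eliminated, and the differential error obeys the Schur complement.
Its correction term `K` is the one appearing in `λ₂`, so the same estimate for k = 1 gives a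
quadratic Lyapunov function (`tendsto_zero_of_decomposition`).

The bound (1) itself rests on joint observability (`posDef_jointMatrix`): a vector on which the form
vanishes is a consensus vector invisible to every agent. -/

namespace DistObs

/-! ### The Laplacian of a strongly connected digraph and its left null vector. -/

section Graph

variable {N : ℕ} (G : Digraph (Fin N))

theorem adj_nonneg (i j : Fin N) : 0 ≤ adj G i j := by
  unfold adj
  simp only [Matrix.of_apply]
  split_ifs <;> norm_num

variable {G} in
theorem adj_of_adj {i j : Fin N} (h : G.Adj j i) : adj G i j = 1 := by
  simp [adj, h]

theorem lap_mulVec_apply (x : Fin N → ℝ) (i : Fin N) :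
    (lap G *ᵥ x) i = ∑ j, adj G i j * (x i - x j) := by
  simp only [lap, Matrix.sub_mulVec, Pi.sub_apply, Matrix.mulVec_diagonal, mul_sub,
    Finset.sum_sub_distrib, Finset.sum_mul]
  rfl

theorem vecMul_lap_apply (w : Fin N → ℝ) (j : Fin N) :
    (w ᵥ* lap G) j = w j * ∑ i, adj G j i - ∑ i, w i * adj G i j := by
  simp only [lap, Matrix.vecMul_sub, Pi.sub_apply, Matrix.vecMul_diagonal]
  rfl

/-- The triangle inequality gives one inequality per column. Summed over all columns both sides
agree, so each inequality is an equality. -/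
theorem abs_vecMul_lap {w : Fin N → ℝ} (hw : w ᵥ* lap G = 0) :
    (fun i => |w i|) ᵥ* lap G = 0 := by
  have h1 : ∀ j, |w j| * ∑ i, adj G j i ≤ ∑ i, |w i| * adj G i j := by
    intro j
    have h := congrFun hw j
    rw [vecMul_lap_apply, Pi.zero_apply, sub_eq_zero] at h
    rw [← abs_of_nonneg (Finset.sum_nonneg fun i _ => adj_nonneg G j i), ← abs_mul, h]
    refine (Finset.abs_sum_le_sum_abs _ _).trans_eq ?_
    simp only [abs_mul, abs_of_nonneg (adj_nonneg G _ _)]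
  have h2 : ∑ j, |w j| * ∑ i, adj G j i = ∑ j, ∑ i, |w i| * adj G i j := by
    rw [Finset.sum_comm]
    simp only [Finset.mul_sum]
  have h3 := (Finset.sum_eq_sum_iff_of_le fun j _ => h1 j).1 h2
  funext j
  rw [vecMul_lap_apply, h3 j (Finset.mem_univ j), sub_self, Pi.zero_apply]

variable {G}

/-- A Perron–Frobenius argument by hand: `L 1 = 0` makes `L` singular, a left null vector may be
replaced by its absolute value, and strong connectivity excludes zero entries. -/
theorem exists_isLeftVector (hG : StronglyConnected G) : ∃ r, IsLeftVector G r := by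
  rcases Nat.eq_zero_or_pos N with rfl | hN
  · exact ⟨0, fun i => i.elim0, funext fun i => i.elim0, by simp⟩
  have : Nonempty (Fin N) := ⟨⟨0, hN⟩⟩
  have hdet : (lap G).det = 0 := by
    refine Matrix.exists_mulVec_eq_zero_iff.1 ⟨1, one_ne_zero, ?_⟩
    funext i
    simp [lap_mulVec_apply]
  obtain ⟨w, hw0, hw⟩ := Matrix.exists_vecMul_eq_zero_iff.2 hdet
  have habs := abs_vecMul_lap G hw
  -- At a node of weight zero the null equation says that a sum of nonnegative terms vanishes, so
  -- zeros spread along arcs.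
  have hstep : ∀ i j, G.Adj i j → w i = 0 → w j = 0 := by
    intro i j hij hi
    have h := congrFun habs i
    rw [vecMul_lap_apply, hi] at h
    simp only [abs_zero, zero_mul, zero_sub, Pi.zero_apply, neg_eq_zero] at h
    rw [Finset.sum_eq_zero_iff_of_nonneg
      fun k _ => mul_nonneg (abs_nonneg _) (adj_nonneg G _ _)] at h
    simpa [adj_of_adj hij] using h j (Finset.mem_univ j)
  have hne : ∀ i, w i ≠ 0 := by
    intro i hi
    refine hw0 (funext fun j => ?_)
    induction hG i j with
    | refl => exact hi
    | tail _ hab ih => exact hstep _ _ hab ih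
  have hsum : 0 < ∑ i, |w i| :=
    Finset.sum_pos (fun i _ => abs_pos.2 (hne i)) Finset.univ_nonempty
  refine ⟨(N / ∑ i, |w i|) • fun i => |w i|, fun i => ?_, ?_, ?_⟩
  · have := abs_pos.2 (hne i)
    have : (0 : ℝ) < N := by exact_mod_cast hN
    simp only [Pi.smul_apply, smul_eq_mul]
    positivity
  · rw [Matrix.smul_vecMul, habs, smul_zero]
  · simp only [Pi.smul_apply, smul_eq_mul, ← Finset.mul_sum]
    field_simp

/-- The form is `∑ rᵢ αᵢⱼ 2 xᵢ(xᵢ - xⱼ)`. Pairing `rᵀ L = 0` with the vector `x²` gives `∑ rᵢ αᵢⱼ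
(xᵢ² - xⱼ²) = 0`; subtracting it completes the squares. -/
theorem dotProduct_symLap {r : Fin N → ℝ} (hr : IsLeftVector G r) (x : Fin N → ℝ) :
    x ⬝ᵥ symLap G r *ᵥ x = ∑ i, ∑ j, r i * adj G i j * (x i - x j) ^ 2 := by
  have h1 : x ⬝ᵥ (Matrix.diagonal r * lap G) *ᵥ x
      = ∑ i, ∑ j, r i * adj G i j * (x i * (x i - x j)) := by
    rw [← Matrix.mulVec_mulVec]
    simp only [dotProduct, Matrix.mulVec_diagonal, lap_mulVec_apply, Finset.mul_sum]
    exact Finset.sum_congr rfl fun i _ => Finset.sum_congr rfl fun j _ => by ring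
  have h2 : (lap G)ᵀ * Matrix.diagonal r = (Matrix.diagonal r * lap G)ᵀ := by
    rw [Matrix.transpose_mul, Matrix.diagonal_transpose]
  have h3 : ∑ i, ∑ j, r i * adj G i j * (x i ^ 2 - x j ^ 2) = 0 := by
    have h := congrArg (· ⬝ᵥ fun i => x i ^ 2) hr.left_null
    simp only [← Matrix.dotProduct_mulVec, zero_dotProduct] at h
    simpa only [dotProduct, lap_mulVec_apply, Finset.mul_sum, mul_assoc] using h
  rw [symLap, h2, Matrix.add_mulVec, dotProduct_add, Matrix.mulVec_transpose,
    dotProduct_comm x (x ᵥ* _), ← Matrix.dotProduct_mulVec, h1]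
  rw [← sub_eq_zero, ← h3]
  simp only [← Finset.sum_add_distrib, ← Finset.sum_sub_distrib]
  exact Finset.sum_congr rfl fun i _ => Finset.sum_congr rfl fun j _ => by ring

theorem symLap_nonneg {r : Fin N → ℝ} (hr : IsLeftVector G r) (x : Fin N → ℝ) :
    0 ≤ x ⬝ᵥ symLap G r *ᵥ x := by
  rw [dotProduct_symLap hr]
  exact Finset.sum_nonneg fun i _ => Finset.sum_nonneg fun j _ =>
    mul_nonneg (mul_nonneg (hr.pos i).le (adj_nonneg G i j)) (sq_nonneg _)

theorem eq_of_symLap_eq_zero (hG : StronglyConnected G) {r : Fin N → ℝ} (hr : IsLeftVector G r)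
    {x : Fin N → ℝ} (hx : x ⬝ᵥ symLap G r *ᵥ x = 0) (i j : Fin N) : x i = x j := by
  rw [dotProduct_symLap hr] at hx
  have hnn : ∀ i j, 0 ≤ r i * adj G i j * (x i - x j) ^ 2 := fun i j =>
    mul_nonneg (mul_nonneg (hr.pos i).le (adj_nonneg G i j)) (sq_nonneg _)
  rw [Finset.sum_eq_zero_iff_of_nonneg fun i _ => Finset.sum_nonneg fun j _ => hnn i j] at hx
  have hstep : ∀ a b, G.Adj a b → x a = x b := by
    intro a b hab
    have h := hx b (Finset.mem_univ b)
    rw [Finset.sum_eq_zero_iff_of_nonneg fun j _ => hnn b j] at h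
    have h' := h a (Finset.mem_univ a)
    rw [adj_of_adj hab] at h'
    have := (hr.pos b).ne'
    have : x b - x a = 0 := by simpa [this] using h'
    linarith
  induction hG i j with
  | refl => rfl
  | tail _ hab ih => exact ih.trans (hstep _ _ hab)

theorem symLap_transpose (r : Fin N → ℝ) : (symLap G r)ᵀ = symLap G r := by
  simp [symLap, Matrix.transpose_mul, add_comm]

end Graph

/-! ### Calculus of `M ⊗ I` and of block diagonal matrices. -/

section Kron

variable {N : ℕ} {κ : Type*} [DecidableEq κ]

theorem kronOne_transpose (M : Matrix (Fin N) (Fin N) ℝ) :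
    (kronOne M κ)ᵀ = kronOne Mᵀ κ := by
  ext a b
  simp [kronOne, Matrix.one_apply, eq_comm]

theorem kronOne_add (M M' : Matrix (Fin N) (Fin N) ℝ) :
    kronOne (M + M') κ = kronOne M κ + kronOne M' κ := by
  ext a b
  simp [kronOne, add_mul]

theorem kronOne_mulVec_apply [Fintype κ] (M : Matrix (Fin N) (Fin N) ℝ)
    (z : (Σ _ : Fin N, κ) → ℝ) (i : Fin N) (c : κ) :
    (kronOne M κ *ᵥ z) ⟨i, c⟩ = (M *ᵥ fun j => z ⟨j, c⟩) i := by
  simp [Matrix.mulVec, dotProduct, kronOne, Fintype.sum_sigma, Matrix.one_apply]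

theorem dotProduct_kronOne [Fintype κ] (M : Matrix (Fin N) (Fin N) ℝ)
    (z : (Σ _ : Fin N, κ) → ℝ) :
    z ⬝ᵥ kronOne M κ *ᵥ z = ∑ c, (fun i => z ⟨i, c⟩) ⬝ᵥ M *ᵥ fun i => z ⟨i, c⟩ := by
  simp only [dotProduct, Fintype.sum_sigma, kronOne_mulVec_apply]
  exact Finset.sum_comm

theorem kronOne_mul [Fintype κ] (M M' : Matrix (Fin N) (Fin N) ℝ) :
    kronOne M κ * kronOne M' κ = kronOne (M * M') κ := by
  ext a b
  simp [Matrix.mul_apply, kronOne, Fintype.sum_sigma, Matrix.one_apply]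

theorem kronOne_diagonal (r : Fin N → ℝ) :
    kronOne (Matrix.diagonal r) κ = Matrix.blockDiagonal' fun i => r i • (1 : Matrix κ κ ℝ) := by
  ext ⟨i, a⟩ ⟨j, b⟩
  rcases eq_or_ne i j with rfl | h
  · simp [kronOne, Matrix.blockDiagonal'_apply]
  · simp [kronOne, Matrix.blockDiagonal'_apply, h]

theorem kronOne_mul_blockDiagonal' {κ' : Type*} [Fintype κ] [Fintype κ'] [DecidableEq κ']
    (M : Matrix (Fin N) (Fin N) ℝ) (B : Matrix κ κ' ℝ) :
    kronOne M κ * (Matrix.blockDiagonal' (fun _ => B) :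
        Matrix (Σ _ : Fin N, κ) (Σ _ : Fin N, κ') ℝ) =
      (Matrix.blockDiagonal' (fun _ => B) :
        Matrix (Σ _ : Fin N, κ) (Σ _ : Fin N, κ') ℝ) * kronOne M κ' := by
  ext ⟨i, a⟩ ⟨j, b⟩
  rw [Matrix.mul_apply, Matrix.mul_apply]
  simp [kronOne, Fintype.sum_sigma, Matrix.one_apply, Matrix.blockDiagonal'_apply, mul_comm]

end Kron

theorem blockDiagonal'_mulVec_apply {N : ℕ} {m' n' : Fin N → Type*} [∀ i, Fintype (n' i)]
    (M : ∀ i, Matrix (m' i) (n' i) ℝ) (y : (Σ i, n' i) → ℝ) (i : Fin N) (a : m' i) :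
    (Matrix.blockDiagonal' M *ᵥ y) ⟨i, a⟩ = (M i *ᵥ fun b => y ⟨i, b⟩) a := by
  simp only [Matrix.mulVec, dotProduct, Fintype.sum_sigma]
  rw [Finset.sum_eq_single i]
  · simp
  · intro j _ hj
    simp [Matrix.blockDiagonal'_apply_ne M _ _ hj.symm]
  · simp

/-! ### Quadratic forms, eigenvalue bounds and Lyapunov's theorem. -/

section Forms

variable {ι : Type*} [Fintype ι]

theorem posDef_of_transpose_eq {M : Matrix ι ι ℝ} (hM : Mᵀ = M)
    (h : ∀ x, x ≠ 0 → 0 < x ⬝ᵥ M *ᵥ x) : M.PosDef :=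
  .of_dotProduct_mulVec_pos (by simpa [Matrix.IsHermitian] using hM) fun x hx => by
    simpa using h x hx

theorem posDef_form_pos {M : Matrix ι ι ℝ} (hM : M.PosDef) {x : ι → ℝ} (hx : x ≠ 0) :
    0 < x ⬝ᵥ M *ᵥ x := by
  simpa using hM.dotProduct_mulVec_pos hx

theorem posDef_form_nonneg {M : Matrix ι ι ℝ} (hM : M.PosDef) (x : ι → ℝ) :
    0 ≤ x ⬝ᵥ M *ᵥ x := by
  simpa using hM.posSemidef.dotProduct_mulVec_nonneg x

omit [Fintype ι] in
theorem posDef_transpose_eq {M : Matrix ι ι ℝ} (hM : M.PosDef) : Mᵀ = M := by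
  simpa [Matrix.IsHermitian] using hM.isHermitian

theorem form_transpose (M : Matrix ι ι ℝ) (x : ι → ℝ) : x ⬝ᵥ Mᵀ *ᵥ x = x ⬝ᵥ M *ᵥ x := by
  rw [Matrix.mulVec_transpose, dotProduct_comm, ← Matrix.dotProduct_mulVec]

theorem form_conj {κ : Type*} [Fintype κ] (M : Matrix ι ι ℝ) (T : Matrix ι κ ℝ) (y : κ → ℝ) :
    y ⬝ᵥ (Tᵀ * M * T) *ᵥ y = (T *ᵥ y) ⬝ᵥ M *ᵥ (T *ᵥ y) := by
  rw [Matrix.mul_assoc, ← Matrix.mulVec_mulVec, ← Matrix.mulVec_mulVec, Matrix.mulVec_transpose,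
    dotProduct_comm, ← Matrix.dotProduct_mulVec, dotProduct_comm]

variable [DecidableEq ι]

theorem form_le_eigMax {M : Matrix ι ι ℝ} (hM : Mᵀ = M) (x : ι → ℝ) :
    x ⬝ᵥ M *ᵥ x ≤ eigMax M * (x ⬝ᵥ x) := by
  have hH : M.IsHermitian := by simpa [Matrix.IsHermitian] using hM
  -- The supremum defining `eigMax` bounds the eigenvalues only because the spectrum is bounded
  -- above.
  have hbdd : BddAbove (spectrum ℝ M) := by
    rw [hH.spectrum_real_eq_range_eigenvalues]
    exact (Set.finite_range _).bddAbove
  have hH' : (eigMax M • (1 : Matrix ι ι ℝ) - M).IsHermitian := by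
    simp [Matrix.IsHermitian, hM]
  have hpsd : (eigMax M • (1 : Matrix ι ι ℝ) - M).PosSemidef := by
    rw [hH'.posSemidef_iff_eigenvalues_nonneg]
    intro i
    have h := hH'.eigenvalues_mem_spectrum_real i
    generalize hH'.eigenvalues i = d at h ⊢
    rw [← Algebra.algebraMap_eq_smul_one, ← spectrum.singleton_sub_eq] at h
    obtain ⟨a, ha, b, hb, hab⟩ := Set.mem_sub.1 h
    rw [Set.mem_singleton_iff] at ha
    have := le_csSup hbdd hb
    simp only [← hab, ha, eigMax, Pi.zero_apply]
    linarith
  have h := hpsd.dotProduct_mulVec_nonneg x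
  simp only [star_trivial, Matrix.sub_mulVec, Matrix.smul_mulVec, Matrix.one_mulVec,
    dotProduct_sub, dotProduct_smul, smul_eq_mul] at h
  linarith

/-- Cauchy–Schwarz and the operator norm; no symmetry is needed. -/
theorem form_le_sigmaMax (M : Matrix ι ι ℝ) (x : ι → ℝ) :
    x ⬝ᵥ M *ᵥ x ≤ sigmaMax M * (x ⬝ᵥ x) := by
  set L := Matrix.toEuclideanCLM (n := ι) (𝕜 := ℝ) M
  set v : EuclideanSpace ℝ ι := WithLp.toLp 2 x
  have h1 : x ⬝ᵥ M *ᵥ x = inner ℝ (L v) v := by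
    rw [EuclideanSpace.inner_eq_star_dotProduct]
    simp [L, v]
  have h2 : x ⬝ᵥ x = ‖v‖ * ‖v‖ := by
    rw [← real_inner_self_eq_norm_mul_norm, EuclideanSpace.inner_eq_star_dotProduct]
    simp [v]
  rw [h1, h2, ← mul_assoc]
  refine (real_inner_le_norm _ _).trans ?_
  gcongr
  exact L.le_opNorm v

theorem exists_pos_posDef_sub {M : Matrix ι ι ℝ} (hM : M.PosDef) :
    ∃ δ : ℝ, 0 < δ ∧ (M - δ • 1).PosDef := by
  have hT : (-M)ᵀ = -M := by rw [Matrix.transpose_neg, posDef_transpose_eq hM]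
  have key : ∃ δ : ℝ, 0 < δ ∧ ∀ x, δ * (x ⬝ᵥ x) ≤ x ⬝ᵥ M *ᵥ x := by
    rcases isEmpty_or_nonempty ι with hι | hι
    · exact ⟨1, one_pos, fun x => by simp [dotProduct]⟩
    obtain ⟨i, hi⟩ := Finite.exists_min hM.isHermitian.eigenvalues
    -- The smallest eigenvalue of `M` is read off from the largest one of `-M`.
    refine ⟨hM.isHermitian.eigenvalues i, hM.eigenvalues_pos i, fun x => ?_⟩
    have h := form_le_eigMax hT x
    have hle : eigMax (-M) ≤ -hM.isHermitian.eigenvalues i := by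
      refine csSup_le ?_ fun b hb => ?_
      · rw [← spectrum.neg_eq]
        exact ⟨-hM.isHermitian.eigenvalues i, by
          simpa using hM.isHermitian.eigenvalues_mem_spectrum_real i⟩
      · rw [← spectrum.neg_eq, Set.mem_neg, hM.isHermitian.spectrum_real_eq_range_eigenvalues] at hb
        obtain ⟨j, hj⟩ := hb
        have := hi j
        linarith
    have h0 : 0 ≤ x ⬝ᵥ x := by simpa using dotProduct_star_self_nonneg x
    have := mul_le_mul_of_nonneg_right hle h0
    rw [Matrix.neg_mulVec, dotProduct_neg] at h
    linarith
  obtain ⟨δ, hδ, h⟩ := key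
  -- Halving turns the weak bound into strict definiteness.
  refine ⟨δ / 2, by positivity, posDef_of_transpose_eq ?_ fun x hx => ?_⟩
  · simp [posDef_transpose_eq hM]
  · have h0 : 0 < x ⬝ᵥ x := by simpa using Matrix.dotProduct_star_self_pos_iff.2 hx
    rw [Matrix.sub_mulVec, dotProduct_sub, Matrix.smul_mulVec, dotProduct_smul, Matrix.one_mulVec,
      smul_eq_mul]
    nlinarith [h x]

theorem exists_pos_form_ge {M : Matrix ι ι ℝ} (hM : M.PosDef) :
    ∃ δ : ℝ, 0 < δ ∧ ∀ x, δ * (x ⬝ᵥ x) ≤ x ⬝ᵥ M *ᵥ x := by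
  obtain ⟨δ, hδ, h⟩ := exists_pos_posDef_sub hM
  refine ⟨δ, hδ, fun x => ?_⟩
  have := posDef_form_nonneg h x
  rw [Matrix.sub_mulVec, dotProduct_sub, Matrix.smul_mulVec, dotProduct_smul, Matrix.one_mulVec,
    smul_eq_mul] at this
  linarith

/-- With `V = zᵀ Y z` one has `V' ≤ -c V`, so `exp (c t) V` is nonincreasing and `V`, hence `z`,
decays exponentially. -/
theorem tendsto_zero_of_lyapunov {M Y : Matrix ι ι ℝ} (hY : Y.PosDef)
    (hM : (-(Y * M + (Y * M)ᵀ)).PosDef) {z : ℝ → ι → ℝ}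
    (hz : ∀ t, 0 < t → HasDerivAt z (M *ᵥ z t) t) : Tendsto z atTop (𝓝 0) := by
  obtain ⟨δ, hδ, hδY⟩ := exists_pos_form_ge hY
  obtain ⟨ε, hε, hεM⟩ := exists_pos_form_ge hM
  -- The added `1` keeps `C` positive also for an empty index type.
  set C := sigmaMax Y + 1
  have hC : 0 < C := by
    have : 0 ≤ sigmaMax Y := norm_nonneg _
    positivity
  have hself : ∀ x : ι → ℝ, 0 ≤ x ⬝ᵥ x := fun x => by simpa using dotProduct_star_self_nonneg x
  have hCY : ∀ x, x ⬝ᵥ Y *ᵥ x ≤ C * (x ⬝ᵥ x) := fun x => by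
    have := form_le_sigmaMax Y x
    have := hself x
    simp only [C]
    linarith
  set V : ℝ → ℝ := fun t => z t ⬝ᵥ Y *ᵥ z t
  set c := ε / C
  have hc : 0 < c := div_pos hε hC
  have hdot : ∀ (f g : ℝ → ι → ℝ) (f' g' : ι → ℝ) (t : ℝ), HasDerivAt f f' t →
      HasDerivAt g g' t → HasDerivAt (fun s => f s ⬝ᵥ g s) (f' ⬝ᵥ g t + f t ⬝ᵥ g') t := by
    intro f g f' g' t hf hg
    rw [hasDerivAt_pi] at hf hg
    simp only [dotProduct, ← Finset.sum_add_distrib]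
    exact HasDerivAt.fun_sum fun i _ => (hf i).mul (hg i)
  have hYz : ∀ t, 0 < t → HasDerivAt (fun s => Y *ᵥ z s) (Y *ᵥ (M *ᵥ z t)) t := by
    intro t ht
    exact (Y.mulVecLin.toContinuousLinearMap.hasFDerivAt.comp_hasDerivAt t (hz t ht))
  have hV : ∀ t, 0 < t → HasDerivAt V (z t ⬝ᵥ (Y * M + (Y * M)ᵀ) *ᵥ z t) t := by
    intro t ht
    refine (hdot _ _ _ _ t (hz t ht) (hYz t ht)).congr_deriv ?_
    rw [Matrix.add_mulVec, dotProduct_add, form_transpose, ← Matrix.mulVec_mulVec]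
    congr 1
    rw [Matrix.dotProduct_mulVec (z t), ← Matrix.mulVec_transpose, posDef_transpose_eq hY,
      dotProduct_comm]
  have hV' : ∀ t, z t ⬝ᵥ (Y * M + (Y * M)ᵀ) *ᵥ z t ≤ -c * V t := by
    intro t
    have h1 := hεM (z t)
    rw [Matrix.neg_mulVec, dotProduct_neg] at h1
    have h2 : c * V t ≤ ε * (z t ⬝ᵥ z t) := by
      have := mul_le_mul_of_nonneg_left (hCY (z t)) hc.le
      rwa [← mul_assoc, div_mul_cancel₀ _ hC.ne'] at this
    linarith
  set g : ℝ → ℝ := fun t => Real.exp (c * t) * V t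
  have hg : ∀ t, 0 < t → HasDerivAt g (Real.exp (c * t) *
      (c * V t + z t ⬝ᵥ (Y * M + (Y * M)ᵀ) *ᵥ z t)) t := by
    intro t ht
    have h1 : HasDerivAt (fun s => Real.exp (c * s)) (Real.exp (c * t) * c) t := by
      simpa using ((hasDerivAt_id t).const_mul c).exp
    exact (h1.mul (hV t ht)).congr_deriv (by ring)
  -- Time starts at `1` because nothing is known about the trajectory at `0`.
  have hanti : AntitoneOn g (Set.Ici 1) := by
    refine antitoneOn_of_deriv_nonpos (convex_Ici 1) ?_ ?_ ?_
    · exact fun t ht => (hg t (zero_lt_one.trans_le ht)).continuousAt.continuousWithinAt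
    · intro t ht
      rw [interior_Ici] at ht
      exact (hg t (zero_lt_one.trans ht)).differentiableAt.differentiableWithinAt
    · intro t ht
      rw [interior_Ici] at ht
      rw [(hg t (zero_lt_one.trans ht)).deriv]
      exact mul_nonpos_of_nonneg_of_nonpos (Real.exp_pos _).le (by linarith [hV' t])
  have hbound : ∀ t, 1 ≤ t → z t ⬝ᵥ z t ≤ g 1 / δ * Real.exp (-(c * t)) := by
    intro t ht
    have h1 : g t ≤ g 1 := hanti Set.self_mem_Ici ht ht
    have h2 := hδY (z t)
    have h3 : V t = g t * Real.exp (-(c * t)) := by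
      simp only [g]
      rw [mul_right_comm, ← Real.exp_add]
      simp
    rw [div_mul_eq_mul_div, le_div_iff₀ hδ, mul_comm]
    refine h2.trans (h3.le.trans ?_)
    gcongr
  have hlim : Tendsto (fun t => g 1 / δ * Real.exp (-(c * t))) atTop (𝓝 0) := by
    have : Tendsto (fun t : ℝ => c * t) atTop atTop := tendsto_id.const_mul_atTop hc
    simpa using (Real.tendsto_exp_neg_atTop_nhds_zero.comp this).const_mul (g 1 / δ)
  have hzz : Tendsto (fun t => z t ⬝ᵥ z t) atTop (𝓝 0) :=
    tendsto_of_tendsto_of_tendsto_of_le_of_le' tendsto_const_nhds hlim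
      (Eventually.of_forall fun t => hself _) ((eventually_ge_atTop 1).mono hbound)
  rw [tendsto_pi_nhds]
  intro i
  have hsq : Tendsto (fun t => z t i ^ 2) atTop (𝓝 0) := by
    refine squeeze_zero (fun t => sq_nonneg _) (fun t => ?_) hzz
    rw [pow_two]
    exact Finset.single_le_sum (f := fun i => z t i * z t i) (fun j _ => mul_self_nonneg _)
      (Finset.mem_univ i)
  have h := hsq.sqrt
  simp only [Real.sqrt_sq_eq_abs, Real.sqrt_zero] at h
  exact (tendsto_zero_iff_abs_tendsto_zero _).2 h

end Forms

/-! ### Positive definiteness of block diagonal matrices. -/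

section BlockForms

variable {N : ℕ} {κ : Fin N → Type*} [∀ i, Fintype (κ i)]

theorem form_blockDiagonal' (M : ∀ i, Matrix (κ i) (κ i) ℝ) (y : (Σ i, κ i) → ℝ) :
    y ⬝ᵥ Matrix.blockDiagonal' M *ᵥ y =
      ∑ i, (fun b => y ⟨i, b⟩) ⬝ᵥ M i *ᵥ fun b => y ⟨i, b⟩ := by
  simp only [dotProduct, Fintype.sum_sigma, blockDiagonal'_mulVec_apply]

theorem posDef_blockDiagonal' {M : ∀ i, Matrix (κ i) (κ i) ℝ} (hM : ∀ i, (M i).PosDef) :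
    (Matrix.blockDiagonal' M).PosDef := by
  refine posDef_of_transpose_eq ?_ fun y hy => ?_
  · rw [Matrix.blockDiagonal'_transpose]
    exact congrArg _ (funext fun i => posDef_transpose_eq (hM i))
  · rw [form_blockDiagonal']
    obtain ⟨⟨i, a⟩, hia⟩ := Function.ne_iff.1 hy
    refine Finset.sum_pos' (fun j _ => posDef_form_nonneg (hM j) _) ⟨i, Finset.mem_univ i, ?_⟩
    exact posDef_form_pos (hM i) fun h => hia (congrFun h a)

theorem posDef_fromBlocks {m n : Type*} [Fintype m] [Fintype n] {A : Matrix m m ℝ}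
    {B : Matrix n n ℝ} (hA : A.PosDef) (hB : B.PosDef) :
    (Matrix.fromBlocks A 0 0 B).PosDef := by
  refine posDef_of_transpose_eq ?_ fun y hy => ?_
  · rw [Matrix.fromBlocks_transpose, posDef_transpose_eq hA, posDef_transpose_eq hB]
    simp
  · have hform : y ⬝ᵥ Matrix.fromBlocks A 0 0 B *ᵥ y =
        (y ∘ Sum.inl) ⬝ᵥ A *ᵥ (y ∘ Sum.inl) + (y ∘ Sum.inr) ⬝ᵥ B *ᵥ (y ∘ Sum.inr) := by
      simp [Matrix.fromBlocks_mulVec, dotProduct, Fintype.sum_sum_type]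
    rw [hform]
    by_cases h : y ∘ Sum.inl = 0
    · have h' : y ∘ Sum.inr ≠ 0 := fun h' => hy <| funext fun a => by
        rcases a with a | a
        · exact congrFun h a
        · exact congrFun h' a
      exact add_pos_of_nonneg_of_pos (posDef_form_nonneg hA _) (posDef_form_pos hB h')
    · exact add_pos_of_pos_of_nonneg (posDef_form_pos hA h) (posDef_form_nonneg hB _)

end BlockForms

/-! ### Joint observability and the Lyapunov inequality for one diagonal block. -/

section Family

variable {N k : ℕ} {p : Fin N → ℕ} {C : ∀ i, Matrix (Fin (p i)) (Fin k) ℝ}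
  {A : Matrix (Fin k) (Fin k) ℝ}

/-- The vectors `T col {0, u}` form an `A`-invariant subspace, on which `A` acts as `Au`. As `C T =
[Co 0]`, this subspace also lies in the kernel of `C`, so it is unobservable. -/
theorem ObsDecomp.pow_mulVec {q : ℕ} {C : Matrix (Fin q) (Fin k) ℝ} (D : ObsDecomp C A)
    (u : Fin D.u → ℝ) (j : ℕ) :
    A ^ j *ᵥ (D.T *ᵥ Sum.elim 0 u) = D.T *ᵥ Sum.elim 0 (D.Au ^ j *ᵥ u) := by
  have hAT : A * D.T = D.T * Matrix.fromBlocks D.Ao 0 D.Ar D.Au := by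
    rw [← D.TAT, ← Matrix.mul_assoc, ← Matrix.mul_assoc, D.mul_transpose_self, Matrix.one_mul]
  induction j with
  | zero => simp
  | succ j ih =>
    rw [pow_succ', ← Matrix.mulVec_mulVec, ih, Matrix.mulVec_mulVec, hAT, ← Matrix.mulVec_mulVec,
      Matrix.fromBlocks_mulVec, pow_succ', ← Matrix.mulVec_mulVec]
    simp only [Sum.elim_comp_inl, Sum.elim_comp_inr, Matrix.mulVec_zero, Matrix.zero_mulVec,
      add_zero, zero_add]

theorem ObsDecomp.output_pow_mulVec {q : ℕ} {C : Matrix (Fin q) (Fin k) ℝ} (D : ObsDecomp C A)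
    (u : Fin D.u → ℝ) (j : ℕ) : (C * A ^ j) *ᵥ (D.T *ᵥ Sum.elim 0 u) = 0 := by
  rw [← Matrix.mulVec_mulVec, D.pow_mulVec, Matrix.mulVec_mulVec, D.CT, Matrix.fromCols_mulVec]
  simp

theorem bigT_transpose_mul_self (D : ∀ i, ObsDecomp (C i) A) : (bigT D)ᵀ * bigT D = 1 := by
  rw [bigT, Matrix.blockDiagonal'_transpose, ← Matrix.blockDiagonal'_mul,
    ← Matrix.blockDiagonal'_one]
  exact congrArg _ (funext fun i => (D i).transpose_mul_self)

theorem bigT_mul_transpose_self (D : ∀ i, ObsDecomp (C i) A) : bigT D * (bigT D)ᵀ = 1 := by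
  rw [bigT, Matrix.blockDiagonal'_transpose, ← Matrix.blockDiagonal'_mul,
    ← Matrix.blockDiagonal'_one]
  exact congrArg _ (funext fun i => (D i).mul_transpose_self)

theorem form_bigG (D : ∀ i, ObsDecomp (C i) A) (g : Fin N → ℝ)
    (y : (Σ i, Fin (D i).v ⊕ Fin (D i).u) → ℝ) :
    y ⬝ᵥ bigG D g *ᵥ y = ∑ i, g i * ∑ a, y ⟨i, Sum.inl a⟩ ^ 2 := by
  rw [bigG, form_blockDiagonal']
  refine Finset.sum_congr rfl fun i _ => ?_
  rw [Matrix.smul_mulVec, dotProduct_smul, smul_eq_mul]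
  congr 1
  simp [Matrix.fromBlocks_mulVec, dotProduct, Fintype.sum_sum_type, pow_two]

theorem form_bigG_nonneg (D : ∀ i, ObsDecomp (C i) A) {g : Fin N → ℝ} (hg : ∀ i, 0 < g i)
    (y : (Σ i, Fin (D i).v ⊕ Fin (D i).u) → ℝ) : 0 ≤ y ⬝ᵥ bigG D g *ᵥ y := by
  rw [form_bigG]
  exact Finset.sum_nonneg fun i _ =>
    mul_nonneg (hg i).le (Finset.sum_nonneg fun a _ => sq_nonneg _)

theorem bigG_transpose (D : ∀ i, ObsDecomp (C i) A) (g : Fin N → ℝ) :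
    (bigG D g)ᵀ = bigG D g := by
  rw [bigG, Matrix.blockDiagonal'_transpose]
  exact congrArg _ (funext fun i => by simp [Matrix.fromBlocks_transpose])

variable {G : Digraph (Fin N)}

/-- Both summands are nonnegative. If both vanish at `y`, the first makes all blocks of `z = T y`
equal, and the second puts the i-th block into the unobservable subspace of agent `i`. The common
block is then unobservable for the stacked pair, so it is zero. -/
theorem posDef_jointMatrix (hG : StronglyConnected G) {r : Fin N → ℝ} (hr : IsLeftVector G r)
    (hobs : IsObservablePair (stackRows C) A) (D : ∀ i, ObsDecomp (C i) A) :
    ((bigT D)ᵀ * kronOne (symLap G r) (Fin k) * bigT D + bigG D r).PosDef := by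
  refine posDef_of_transpose_eq ?_ fun y hy => ?_
  · rw [Matrix.transpose_add, bigG_transpose, Matrix.transpose_mul, Matrix.transpose_mul,
      kronOne_transpose, symLap_transpose, Matrix.transpose_transpose, Matrix.mul_assoc]
  rw [Matrix.add_mulVec, dotProduct_add, form_conj, dotProduct_kronOne]
  set z := bigT D *ᵥ y
  have hL : ∀ c, 0 ≤ (fun i => z ⟨i, c⟩) ⬝ᵥ symLap G r *ᵥ fun i => z ⟨i, c⟩ :=
    fun c => symLap_nonneg hr _
  have hGn := form_bigG_nonneg D hr.pos y
  by_contra hneg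
  have hLs := Finset.sum_nonneg fun c (_ : c ∈ Finset.univ) => hL c
  have hL0 := le_antisymm (by linarith) hLs
  have hG0 : y ⬝ᵥ bigG D r *ᵥ y = 0 := le_antisymm (by linarith) hGn
  have hzeq : ∀ c i j, z ⟨i, c⟩ = z ⟨j, c⟩ := fun c i j =>
    eq_of_symLap_eq_zero hG hr
      ((Finset.sum_eq_zero_iff_of_nonneg fun c _ => hL c).1 hL0 c (Finset.mem_univ c)) i j
  have hyo : ∀ i a, y ⟨i, Sum.inl a⟩ = 0 := by
    intro i a
    rw [form_bigG, Finset.sum_eq_zero_iff_of_nonneg fun i _ =>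
      mul_nonneg (hr.pos i).le (Finset.sum_nonneg fun a _ => sq_nonneg _)] at hG0
    have h := (mul_eq_zero.1 (hG0 i (Finset.mem_univ i))).resolve_left (hr.pos i).ne'
    rw [Finset.sum_eq_zero_iff_of_nonneg fun a _ => sq_nonneg _] at h
    exact pow_eq_zero_iff two_ne_zero |>.1 (h a (Finset.mem_univ a))
  have hzi : ∀ i, (fun c => z ⟨i, c⟩) =
      (D i).T *ᵥ Sum.elim 0 fun b => y ⟨i, Sum.inr b⟩ := by
    intro i
    funext c
    simp only [z, bigT, blockDiagonal'_mulVec_apply]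
    congr 2
    funext a
    rcases a with a | a
    · exact hyo i a
    · rfl
  have hz : z = 0 := by
    funext ⟨i, c⟩
    refine congrFun (hobs (fun c => z ⟨i, c⟩) fun j => ?_) c
    funext ⟨i', a⟩
    -- For the outputs of agent `i'`, the common vector is represented by that agent's own copy.
    have hi : (fun c => z ⟨i, c⟩) = fun c => z ⟨i', c⟩ := funext fun c => hzeq c i i'
    rw [hi, hzi i', ← Matrix.mulVec_mulVec]
    have := congrFun ((D i').output_pow_mulVec (fun b => y ⟨i', Sum.inr b⟩) j) a
    rw [← Matrix.mulVec_mulVec] at this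
    exact this
  refine hy ?_
  rw [← Matrix.one_mulVec y, ← bigT_transpose_mul_self, ← Matrix.mulVec_mulVec]
  change (bigT D)ᵀ *ᵥ z = 0
  rw [hz, Matrix.mulVec_zero]

/-- Allows one `μ`, the minimum, to serve both families. -/
theorem JointBound.mono {r : Fin N → ℝ} {D : ∀ i, ObsDecomp (C i) A} {μ ν : ℝ}
    (h : JointBound G r D μ) (hν : ν ≤ μ) : JointBound G r D ν := by
  unfold JointBound at h ⊢
  have := h.add_posSemidef (Matrix.PosSemidef.one.smul (sub_nonneg.2 hν))
  convert this using 1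
  rw [sub_smul]
  abel

theorem exists_jointBound (hG : StronglyConnected G) {r : Fin N → ℝ} (hr : IsLeftVector G r)
    (hobs : IsObservablePair (stackRows C) A) (D : ∀ i, ObsDecomp (C i) A) :
    ∃ μ : ℝ, 0 < μ ∧ JointBound G r D μ :=
  exists_pos_posDef_sub (posDef_jointMatrix hG hr hobs D)

/-- The diagonal block of the error dynamics belonging to the family `D`, in the coordinates given
by the observability decompositions. -/
noncomputable def errorBlock (G : Digraph (Fin N)) (D : ∀ i, ObsDecomp (C i) A)
    (Ho : ∀ i, Matrix (Fin (D i).v) (Fin (p i)) ℝ)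
    (Wo : ∀ i, Matrix (Fin (D i).v) (Fin (D i).v) ℝ) (γ : ℝ) :
    Matrix (Σ i, Fin (D i).v ⊕ Fin (D i).u) (Σ i, Fin (D i).v ⊕ Fin (D i).u) ℝ :=
  (bigT D)ᵀ * (Matrix.blockDiagonal' fun i => A - gainT D Ho i * C i) * bigT D -
    γ • ((Matrix.blockDiagonal' fun i => (weightTilde D Wo i)⁻¹) *
      ((bigT D)ᵀ * kronOne (lap G) (Fin k) * bigT D))

/-- The Lyapunov matrix `diag {rᵢ W̃ᵢ}`. -/
noncomputable def lyapMatrix (r : Fin N → ℝ) (D : ∀ i, ObsDecomp (C i) A)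
    (Wo : ∀ i, Matrix (Fin (D i).v) (Fin (D i).v) ℝ) :
    Matrix (Σ i, Fin (D i).v ⊕ Fin (D i).u) (Σ i, Fin (D i).v ⊕ Fin (D i).u) ℝ :=
  Matrix.blockDiagonal' fun i => r i • weightTilde D Wo i

variable {D : ∀ i, ObsDecomp (C i) A} {Ho : ∀ i, Matrix (Fin (D i).v) (Fin (p i)) ℝ}
  {Wo : ∀ i, Matrix (Fin (D i).v) (Fin (D i).v) ℝ} {γ : ℝ}

theorem LocalDesign.posDef_weightTilde (hD : LocalDesign D Ho Wo γ) (i : Fin N) :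
    (weightTilde D Wo i).PosDef :=
  posDef_fromBlocks (hD.posDef i) Matrix.PosDef.one

theorem LocalDesign.weightTilde_mul_inv (hD : LocalDesign D Ho Wo γ) (i : Fin N) :
    weightTilde D Wo i * (weightTilde D Wo i)⁻¹ = 1 :=
  Matrix.mul_nonsing_inv _ ((Matrix.isUnit_iff_isUnit_det _).1 (hD.posDef_weightTilde i).isUnit)

theorem LocalDesign.posDef_lyapMatrix (hD : LocalDesign D Ho Wo γ) {r : Fin N → ℝ}
    (hr : ∀ i, 0 < r i) : (lyapMatrix r D Wo).PosDef :=
  posDef_blockDiagonal' fun i => (hD.posDef_weightTilde i).smul (hr i)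

theorem gainT_eq (D : ∀ i, ObsDecomp (C i) A) (Ho : ∀ i, Matrix (Fin (D i).v) (Fin (p i)) ℝ)
    (i : Fin N) : gainT D Ho i =
      (D i).T * (Matrix.fromRows (Ho i) 0 : Matrix (Fin (D i).v ⊕ Fin (D i).u) (Fin (p i)) ℝ) :=
  rfl

/-- Since `C T = [Co 0]` and the gain is `T col {Ho, 0}`, output injection changes only the
observable diagonal block. -/
theorem transpose_mul_local_mul (D : ∀ i, ObsDecomp (C i) A)
    (Ho : ∀ i, Matrix (Fin (D i).v) (Fin (p i)) ℝ) :
    (bigT D)ᵀ * (Matrix.blockDiagonal' fun i => A - gainT D Ho i * C i) * bigT D =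
      Matrix.blockDiagonal' fun i =>
        Matrix.fromBlocks ((D i).Ao - Ho i * (D i).Co) 0 (D i).Ar (D i).Au := by
  rw [bigT, Matrix.blockDiagonal'_transpose, ← Matrix.blockDiagonal'_mul,
    ← Matrix.blockDiagonal'_mul]
  refine congrArg _ (funext fun i => ?_)
  have h : (D i).Tᵀ * (gainT D Ho i * C i) * (D i).T =
      Matrix.fromBlocks (Ho i * (D i).Co) 0 0 0 := by
    calc (D i).Tᵀ * (gainT D Ho i * C i) * (D i).T
        = ((D i).Tᵀ * (D i).T) *
          (Matrix.fromRows (Ho i) 0 : Matrix (Fin (D i).v ⊕ Fin (D i).u) (Fin (p i)) ℝ) * (C i * (D i).T) := by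
          simp only [gainT_eq, Matrix.mul_assoc]
      _ = _ := by
          rw [(D i).transpose_mul_self, (D i).CT, Matrix.one_mul,
            Matrix.fromRows_mul_fromCols]
          simp
  rw [Matrix.mul_sub, Matrix.sub_mul, h, (D i).TAT, sub_eq_add_neg, Matrix.fromBlocks_neg,
    Matrix.fromBlocks_add]
  simp [sub_eq_add_neg]

/-- The factor `W̃ᵢ` cancels the weight in front of the coupling; what remains is `R ⊗ I`, which
commutes past `Tᵀ` and merges with the Laplacian into `R L`. -/
theorem LocalDesign.lyapMatrix_mul_errorBlock (hD : LocalDesign D Ho Wo γ) (r : Fin N → ℝ) :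
    lyapMatrix r D Wo * errorBlock G D Ho Wo γ =
      (Matrix.blockDiagonal' fun i => r i • Matrix.fromBlocks
        (Wo i * ((D i).Ao - Ho i * (D i).Co)) 0 (D i).Ar (D i).Au) -
      γ • ((bigT D)ᵀ * kronOne (Matrix.diagonal r * lap G) (Fin k) * bigT D) := by
  have h1 : lyapMatrix r D Wo * (Matrix.blockDiagonal' fun i =>
        Matrix.fromBlocks ((D i).Ao - Ho i * (D i).Co) 0 (D i).Ar (D i).Au) =
      Matrix.blockDiagonal' fun i => r i • Matrix.fromBlocks
        (Wo i * ((D i).Ao - Ho i * (D i).Co)) 0 (D i).Ar (D i).Au := by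
    rw [lyapMatrix, ← Matrix.blockDiagonal'_mul]
    refine congrArg _ (funext fun i => ?_)
    rw [Matrix.smul_mul, weightTilde, Matrix.fromBlocks_multiply]
    simp
  have h2 : lyapMatrix r D Wo * (Matrix.blockDiagonal' fun i => (weightTilde D Wo i)⁻¹) *
      (bigT D)ᵀ = (bigT D)ᵀ * kronOne (Matrix.diagonal r) (Fin k) := by
    rw [lyapMatrix, ← Matrix.blockDiagonal'_mul, bigT, Matrix.blockDiagonal'_transpose,
      kronOne_diagonal, ← Matrix.blockDiagonal'_mul, ← Matrix.blockDiagonal'_mul]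
    refine congrArg _ (funext fun i => ?_)
    rw [Matrix.smul_mul, hD.weightTilde_mul_inv, Matrix.smul_mul, Matrix.mul_smul,
      Matrix.one_mul, Matrix.mul_one]
  rw [errorBlock, transpose_mul_local_mul, Matrix.mul_sub, h1, Matrix.mul_smul, ← kronOne_mul]
  congr 2
  rw [← Matrix.mul_assoc, ← Matrix.mul_assoc, ← Matrix.mul_assoc, h2, Matrix.mul_assoc (bigT D)ᵀ]

/-- The Lyapunov equations produce `-2γ G` on the observable blocks, and `R L` symmetrises to
`symLap`. -/
theorem LocalDesign.sym_lyapMatrix_mul_errorBlock (hD : LocalDesign D Ho Wo γ) (r : Fin N → ℝ) :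
    lyapMatrix r D Wo * errorBlock G D Ho Wo γ + (lyapMatrix r D Wo * errorBlock G D Ho Wo γ)ᵀ =
      bigU D r + (bigU D r)ᵀ - (2 * γ) • bigG D r -
      γ • ((bigT D)ᵀ * kronOne (symLap G r) (Fin k) * bigT D) := by
  have h1 : (Matrix.blockDiagonal' fun i => r i • Matrix.fromBlocks
        (Wo i * ((D i).Ao - Ho i * (D i).Co)) 0 (D i).Ar (D i).Au) +
      (Matrix.blockDiagonal' fun i => r i • Matrix.fromBlocks
        (Wo i * ((D i).Ao - Ho i * (D i).Co)) 0 (D i).Ar (D i).Au)ᵀ =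
      bigU D r + (bigU D r)ᵀ - (2 * γ) • bigG D r := by
    rw [bigU, bigG, Matrix.blockDiagonal'_transpose, Matrix.blockDiagonal'_transpose,
      ← Matrix.blockDiagonal'_smul, ← Matrix.blockDiagonal'_add, ← Matrix.blockDiagonal'_add,
      ← Matrix.blockDiagonal'_sub]
    refine congrArg _ (funext fun i => ?_)
    have hl := hD.lyapunov i
    simp only [Pi.add_apply, Pi.sub_apply, Pi.smul_apply, Matrix.transpose_smul]
    rw [smul_comm (2 * γ) (r i), ← smul_add, ← smul_add, ← smul_sub]
    congr 1
    rw [sub_eq_add_neg (_ + _)]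
    rw [Matrix.fromBlocks_transpose, Matrix.fromBlocks_transpose, Matrix.fromBlocks_smul,
      Matrix.fromBlocks_neg, Matrix.fromBlocks_add, Matrix.fromBlocks_add,
      Matrix.fromBlocks_add, hl]
    simp
  have h2 : symLap G r = Matrix.diagonal r * lap G + (Matrix.diagonal r * lap G)ᵀ := by
    rw [symLap, Matrix.transpose_mul, Matrix.diagonal_transpose]
  have h3 : (bigT D)ᵀ * kronOne (symLap G r) (Fin k) * bigT D =
      (bigT D)ᵀ * kronOne (Matrix.diagonal r * lap G) (Fin k) * bigT D +
      ((bigT D)ᵀ * kronOne (Matrix.diagonal r * lap G) (Fin k) * bigT D)ᵀ := by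
    rw [h2, kronOne_add, Matrix.mul_add, Matrix.add_mul, ← kronOne_transpose,
      Matrix.transpose_mul, Matrix.transpose_mul, Matrix.transpose_transpose, Matrix.mul_assoc,
      Matrix.mul_assoc]
  rw [hD.lyapMatrix_mul_errorBlock, ← h1, h3, Matrix.transpose_sub, Matrix.transpose_smul, smul_add]
  abel

/-- The free matrix `K` lets one estimate serve twice: `K = 0` for the algebraic block, the Schur
complement correction for the differential one. -/
theorem LocalDesign.posDef_neg_sym (hD : LocalDesign D Ho Wo γ) {r : Fin N → ℝ}
    (hr : IsLeftVector G r) (hγ : 0 < γ) {μ lam : ℝ} (hμ : JointBound G r D μ)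
    (hlam : lam < γ * μ)
    {K : Matrix (Σ i, Fin (D i).v ⊕ Fin (D i).u) (Σ i, Fin (D i).v ⊕ Fin (D i).u) ℝ}
    (hK : ∀ y, y ⬝ᵥ (bigU D r + (bigU D r)ᵀ - K - Kᵀ) *ᵥ y ≤ lam * (y ⬝ᵥ y)) :
    (-((lyapMatrix r D Wo * errorBlock G D Ho Wo γ - K) +
      (lyapMatrix r D Wo * errorBlock G D Ho Wo γ - K)ᵀ)).PosDef := by
  refine posDef_of_transpose_eq ?_ fun y hy => ?_
  · rw [Matrix.transpose_neg, Matrix.transpose_add, Matrix.transpose_transpose, add_comm]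
  -- Of the two copies of `γ G`, one completes the joint matrix of (1); the other is nonnegative and
  -- is dropped.
  have hsum : lyapMatrix r D Wo * errorBlock G D Ho Wo γ - K +
      (lyapMatrix r D Wo * errorBlock G D Ho Wo γ - K)ᵀ =
      (bigU D r + (bigU D r)ᵀ - K - Kᵀ) -
      γ • ((bigT D)ᵀ * kronOne (symLap G r) (Fin k) * bigT D + bigG D r - μ • 1) -
      γ • bigG D r - (γ * μ) • 1 := by
    have h := hD.sym_lyapMatrix_mul_errorBlock (G := G) r
    rw [Matrix.transpose_sub, sub_add_sub_comm, h]
    module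
  have h1 := posDef_form_pos hμ hy
  have h2 := form_bigG_nonneg D hr.pos y
  have h3 : 0 < y ⬝ᵥ y := by simpa using Matrix.dotProduct_star_self_pos_iff.2 hy
  have h4 := hK y
  rw [hsum]
  generalize bigU D r + (bigU D r)ᵀ - K - Kᵀ = B at h4 ⊢
  generalize (bigT D)ᵀ * kronOne (symLap G r) (Fin k) * bigT D + bigG D r - μ • 1 = J at h1 ⊢
  simp only [Matrix.neg_mulVec, Matrix.sub_mulVec, Matrix.smul_mulVec, Matrix.one_mulVec,
    dotProduct_neg, dotProduct_sub, dotProduct_smul, smul_eq_mul]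
  have := mul_pos hγ h1
  have := mul_nonneg hγ.le h2
  have := mul_pos (sub_pos.2 hlam) h3
  linarith

end Family

/-! ### Admissibility from a decomposition form. -/

section Admissible

variable {ι κ₁ κ₂ : Type*} [Fintype ι] [DecidableEq ι] [Fintype κ₁] [DecidableEq κ₁]
  [Fintype κ₂] [DecidableEq κ₂] {E A Q P : Matrix ι ι ℝ} {e : ι ≃ κ₁ ⊕ κ₂}
  {B11 : Matrix κ₁ κ₁ ℝ} {B12 : Matrix κ₁ κ₂ ℝ} {B21 : Matrix κ₂ κ₁ ℝ} {B22 : Matrix κ₂ κ₂ ℝ}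

theorem impulseFree_of_decomposition (hQ : IsUnit Q) (hP : IsUnit P)
    (hE : (Q * E * P).reindex e e = Matrix.fromBlocks 1 0 0 0)
    (hA : (Q * A * P).reindex e e = Matrix.fromBlocks B11 B12 B21 B22) (hB : IsUnit B22) :
    ImpulseFree E A := by
  -- `ImpulseFree` asks for blocks indexed by `Fin`, so both index types are renumbered.
  let f := Equiv.sumCongr (Fintype.equivFin κ₁) (Fintype.equivFin κ₂)
  refine ⟨_, _, e.trans f, Q, P, hQ, hP, ?_, ?_⟩
  · change ((Q * E * P).reindex e e).reindex f f = _
    rw [hE]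
    ext (a | a) (b | b) <;> simp [f, Matrix.one_apply]
  · change IsUnit (((Q * A * P).reindex e e).reindex f f).toBlocks₂₂
    rw [hA]
    exact (Matrix.isUnit_submatrix_equiv (Fintype.equivFin κ₂).symm (Fintype.equivFin κ₂).symm).2 hB

/-- Invertibility of `B22` expresses the algebraic variables through the differential ones, which
then follow an ODE with the Schur complement as matrix. -/
theorem tendsto_zero_of_decomposition (hP : IsUnit P)
    (hE : (Q * E * P).reindex e e = Matrix.fromBlocks 1 0 0 0)
    (hA : (Q * A * P).reindex e e = Matrix.fromBlocks B11 B12 B21 B22) (hB : IsUnit B22)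
    {Y : Matrix κ₁ κ₁ ℝ} (hY : Y.PosDef)
    (hM : (-(Y * (B11 - B12 * B22⁻¹ * B21) + (Y * (B11 - B12 * B22⁻¹ * B21))ᵀ)).PosDef)
    {z : ℝ → ι → ℝ} (hz : IsTrajectory E A z) : Tendsto z atTop (𝓝 0) := by
  have hPd := (Matrix.isUnit_iff_isUnit_det P).1 hP
  set w : ℝ → κ₁ ⊕ κ₂ → ℝ := fun t => (P⁻¹ *ᵥ z t) ∘ e.symm
  have hconj : ∀ (M : Matrix ι ι ℝ) (B : Matrix (κ₁ ⊕ κ₂) (κ₁ ⊕ κ₂) ℝ),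
      (Q * M * P).reindex e e = B → ∀ t, (Q *ᵥ (M *ᵥ z t)) ∘ e.symm = B *ᵥ w t := by
    rintro M B rfl t
    rw [Matrix.reindex_apply, Matrix.submatrix_mulVec_equiv]
    simp only [w, Function.comp_assoc, Equiv.symm_symm, Equiv.symm_comp_self, Function.comp_id]
    rw [Matrix.mulVec_mulVec, Matrix.mulVec_mulVec, Matrix.mul_assoc _ P, Matrix.mul_nonsing_inv _ hPd,
      Matrix.mul_one]
  have hderiv : ∀ t, 0 < t → HasDerivAt
      (fun s => Matrix.fromBlocks (1 : Matrix κ₁ κ₁ ℝ) 0 0 (0 : Matrix κ₂ κ₂ ℝ) *ᵥ w s)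
      (Matrix.fromBlocks B11 B12 B21 B22 *ᵥ w t) t := by
    intro t ht
    simp only [← hconj E _ hE, ← hconj A _ hA]
    have h := Q.mulVecLin.toContinuousLinearMap.hasFDerivAt.comp_hasDerivAt t (hz t ht)
    rw [hasDerivAt_pi] at h ⊢
    exact fun i => h (e.symm i)
  simp only [Matrix.fromBlocks_mulVec, Matrix.one_mulVec, Matrix.zero_mulVec, add_zero] at hderiv
  set a : ℝ → κ₁ → ℝ := fun t => w t ∘ Sum.inl
  set b : ℝ → κ₂ → ℝ := fun t => w t ∘ Sum.inr
  have hb : ∀ t, 0 < t → b t = -((B22⁻¹ * B21) *ᵥ a t) := by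
    intro t ht
    -- The lower rows of `diag {I, 0} w` are constantly zero, so uniqueness of the derivative yields
    -- the algebraic constraint.
    have h : B21 *ᵥ a t + B22 *ᵥ b t = 0 := by
      funext j
      exact ((hasDerivAt_pi.1 (hderiv t ht)) (Sum.inr j)).unique (hasDerivAt_const t (0 : ℝ))
    have h' := congrArg (B22⁻¹ *ᵥ ·) h
    simp only [Matrix.mulVec_add, Matrix.mulVec_mulVec, Matrix.mulVec_zero,
      Matrix.nonsing_inv_mul _ ((Matrix.isUnit_iff_isUnit_det B22).1 hB), Matrix.one_mulVec] at h'
    exact eq_neg_of_add_eq_zero_right h'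
  have ha : ∀ t, 0 < t → HasDerivAt a ((B11 - B12 * B22⁻¹ * B21) *ᵥ a t) t := by
    intro t ht
    have h : (B11 - B12 * B22⁻¹ * B21) *ᵥ a t = B11 *ᵥ a t + B12 *ᵥ b t := by
      rw [hb t ht, Matrix.sub_mulVec, Matrix.mulVec_neg, Matrix.mulVec_mulVec, ← Matrix.mul_assoc,
        sub_eq_add_neg]
    rw [h, hasDerivAt_pi]
    exact fun i => (hasDerivAt_pi.1 (hderiv t ht)) (Sum.inl i)
  have hat : Tendsto a atTop (𝓝 0) := tendsto_zero_of_lyapunov hY hM ha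
  have hbt : Tendsto b atTop (𝓝 0) := by
    have hc : Continuous fun v : κ₁ → ℝ => -((B22⁻¹ * B21) *ᵥ v) :=
      (Continuous.matrix_mulVec continuous_const continuous_id).neg
    have h := (hc.tendsto 0).comp hat
    simp only [Matrix.mulVec_zero, neg_zero] at h
    exact h.congr' ((eventually_gt_atTop 0).mono fun t ht => (hb t ht).symm)
  have hwt : Tendsto w atTop (𝓝 0) := by
    rw [tendsto_pi_nhds] at hat hbt ⊢
    rintro (i | i)
    exacts [hat i, hbt i]
  have hzw : ∀ t, P *ᵥ (w t ∘ e) = z t := by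
    intro t
    simp only [w, Function.comp_assoc, Equiv.symm_comp_self, Function.comp_id]
    rw [Matrix.mulVec_mulVec, Matrix.mul_nonsing_inv _ hPd, Matrix.one_mulVec]
  have hc : Continuous fun v : κ₁ ⊕ κ₂ → ℝ => P *ᵥ (v ∘ e) :=
    Continuous.matrix_mulVec continuous_const (continuous_pi fun i => continuous_apply (e i))
  have h := (hc.tendsto 0).comp hwt
  have h0 : P *ᵥ ((0 : κ₁ ⊕ κ₂ → ℝ) ∘ e) = 0 := Matrix.mulVec_zero P
  rw [h0] at h
  exact h.congr hzw

end Admissible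

/-! ### Regrouping the stacked state from agents into differential and algebraic parts. -/

section Reindex

variable {N : ℕ}

theorem reindex_blockDiagonal'_fromBlocks {κ₁ κ₂ : Type*} (A : Fin N → Matrix κ₁ κ₁ ℝ)
    (B : Fin N → Matrix κ₁ κ₂ ℝ) (C : Fin N → Matrix κ₂ κ₁ ℝ) (D : Fin N → Matrix κ₂ κ₂ ℝ) :
    (Matrix.blockDiagonal' fun i => Matrix.fromBlocks (A i) (B i) (C i) (D i)).reindex
      (Equiv.sigmaSumDistrib _ _) (Equiv.sigmaSumDistrib _ _) =
    Matrix.fromBlocks (Matrix.blockDiagonal' A) (Matrix.blockDiagonal' B)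
      (Matrix.blockDiagonal' C) (Matrix.blockDiagonal' D) := by
  ext (⟨i, a⟩ | ⟨i, a⟩) (⟨j, b⟩ | ⟨j, b⟩) <;> rcases eq_or_ne i j with rfl | h <;>
    simp [Matrix.blockDiagonal'_apply, Equiv.sigmaSumDistrib, Sigma.map, *]

theorem reindex_kronOne {κ₁ κ₂ : Type*} [DecidableEq κ₁] [DecidableEq κ₂]
    (M : Matrix (Fin N) (Fin N) ℝ) :
    (kronOne M (κ₁ ⊕ κ₂)).reindex (Equiv.sigmaSumDistrib _ _) (Equiv.sigmaSumDistrib _ _) =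
    Matrix.fromBlocks (kronOne M κ₁) 0 0 (kronOne M κ₂) := by
  ext (⟨i, a⟩ | ⟨i, a⟩) (⟨j, b⟩ | ⟨j, b⟩) <;>
    simp [kronOne, Matrix.one_apply, Equiv.sigmaSumDistrib, Sigma.map]

theorem isUnit_blockDiagonal' {κ : Type*} [Fintype κ] [DecidableEq κ] {M : Fin N → Matrix κ κ ℝ}
    (hM : ∀ i, IsUnit (M i)) : IsUnit (Matrix.blockDiagonal' M) := by
  refine IsUnit.of_mul_eq_one (Matrix.blockDiagonal' fun i => (M i)⁻¹) ?_
  rw [← Matrix.blockDiagonal'_mul, ← Matrix.blockDiagonal'_one]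
  exact congrArg _ (funext fun i =>
    Matrix.mul_nonsing_inv _ ((Matrix.isUnit_iff_isUnit_det _).1 (hM i)))

end Reindex

/-! ### Passage between decomposition-form and observability coordinates. -/

section Family

variable {N k : ℕ} {p : Fin N → ℕ} {C : ∀ i, Matrix (Fin (p i)) (Fin k) ℝ}
  {A : Matrix (Fin k) (Fin k) ℝ} {G : Digraph (Fin N)}
  {D : ∀ i, ObsDecomp (C i) A} {Ho : ∀ i, Matrix (Fin (D i).v) (Fin (p i)) ℝ}
  {Wo : ∀ i, Matrix (Fin (D i).v) (Fin (D i).v) ℝ} {γ : ℝ}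

/-- The diagonal block of the error dynamics belonging to the family `D`, in the coordinates of the
dynamic decomposition form. -/
noncomputable def stateBlock (G : Digraph (Fin N)) (D : ∀ i, ObsDecomp (C i) A)
    (Ho : ∀ i, Matrix (Fin (D i).v) (Fin (p i)) ℝ)
    (Wo : ∀ i, Matrix (Fin (D i).v) (Fin (D i).v) ℝ) (γ : ℝ) :
    Matrix (Σ _ : Fin N, Fin k) (Σ _ : Fin N, Fin k) ℝ :=
  (Matrix.blockDiagonal' fun i => A - gainT D Ho i * C i) -
    γ • ((Matrix.blockDiagonal' fun i => (weightT D Wo i)⁻¹) * kronOne (lap G) (Fin k))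

theorem LocalDesign.weightT_mul (hD : LocalDesign D Ho Wo γ) (i : Fin N) :
    weightT D Wo i * ((D i).T * (weightTilde D Wo i)⁻¹ * (D i).Tᵀ) = 1 := by
  calc weightT D Wo i * ((D i).T * (weightTilde D Wo i)⁻¹ * (D i).Tᵀ)
      = (D i).T * (weightTilde D Wo i * ((D i).Tᵀ * (D i).T) * (weightTilde D Wo i)⁻¹) *
          (D i).Tᵀ := by simp only [weightT, Matrix.mul_assoc]
    _ = 1 := by
      rw [(D i).transpose_mul_self, Matrix.mul_one, hD.weightTilde_mul_inv, Matrix.mul_one,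
        (D i).mul_transpose_self]

theorem LocalDesign.isUnit_weightT (hD : LocalDesign D Ho Wo γ) (i : Fin N) :
    IsUnit (weightT D Wo i) :=
  IsUnit.of_mul_eq_one _ (hD.weightT_mul i)

/-- Orthogonality gives `Tᵢᵀ (Tᵢ W̃ᵢ Tᵢᵀ)⁻¹ = W̃ᵢ⁻¹ Tᵢᵀ`. -/
theorem LocalDesign.errorBlock_eq (hD : LocalDesign D Ho Wo γ) :
    errorBlock G D Ho Wo γ = (bigT D)ᵀ * stateBlock G D Ho Wo γ * bigT D := by
  have h : (bigT D)ᵀ * (Matrix.blockDiagonal' fun i => (weightT D Wo i)⁻¹) =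
      (Matrix.blockDiagonal' fun i => (weightTilde D Wo i)⁻¹) * (bigT D)ᵀ := by
    rw [bigT, Matrix.blockDiagonal'_transpose, ← Matrix.blockDiagonal'_mul,
      ← Matrix.blockDiagonal'_mul]
    refine congrArg _ (funext fun i => ?_)
    rw [Matrix.inv_eq_right_inv (hD.weightT_mul i), ← Matrix.mul_assoc, ← Matrix.mul_assoc,
      (D i).transpose_mul_self, Matrix.one_mul]
  rw [errorBlock, stateBlock, Matrix.mul_sub, Matrix.sub_mul, Matrix.mul_smul, Matrix.smul_mul,
    ← Matrix.mul_assoc (bigT D)ᵀ _ (kronOne _ _), h]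
  simp only [Matrix.mul_assoc]

theorem LocalDesign.stateBlock_eq (hD : LocalDesign D Ho Wo γ) :
    stateBlock G D Ho Wo γ = bigT D * errorBlock G D Ho Wo γ * (bigT D)ᵀ := by
  rw [hD.errorBlock_eq]
  calc stateBlock G D Ho Wo γ
      = (bigT D * (bigT D)ᵀ) * stateBlock G D Ho Wo γ * (bigT D * (bigT D)ᵀ) := by
        rw [bigT_mul_transpose_self, Matrix.one_mul, Matrix.mul_one]
    _ = _ := by simp only [Matrix.mul_assoc]

/-- A kernel vector of the block would annihilate the definite form `sym (X * errorBlock)`. -/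
theorem LocalDesign.isUnit_errorBlock (hD : LocalDesign D Ho Wo γ) {r : Fin N → ℝ}
    (hr : IsLeftVector G r) (hγ : 0 < γ) {μ : ℝ} (hμ : JointBound G r D μ)
    (h : sigmaMax (bigU D r + (bigU D r)ᵀ) < γ * μ) : IsUnit (errorBlock G D Ho Wo γ) := by
  have hpd := hD.posDef_neg_sym hr hγ hμ h (K := 0) fun y => by
    simpa using form_le_sigmaMax (bigU D r + (bigU D r)ᵀ) y
  rw [sub_zero] at hpd
  rw [Matrix.isUnit_iff_isUnit_det, isUnit_iff_ne_zero]
  intro h0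
  obtain ⟨x, hx, hEx⟩ := Matrix.exists_mulVec_eq_zero_iff.2 h0
  have hpos := posDef_form_pos hpd hx
  rw [Matrix.neg_mulVec, dotProduct_neg, Matrix.add_mulVec, dotProduct_add, form_transpose,
    ← Matrix.mulVec_mulVec, hEx, Matrix.mulVec_zero, dotProduct_zero] at hpos
  simp at hpos

end Family

/-! ### The error dynamics of the distributed observer. -/

section Observer

variable {N l m : ℕ} {p : Fin N → ℕ} {S : DescriptorSystem N l m p} {F : DDF S}
  {G : Digraph (Fin N)} {D1 : ∀ i, ObsDecomp (F.C1 i) F.A11}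
  {D2 : ∀ i, ObsDecomp (F.C2 i) F.A22} {Ho1 : ∀ i, Matrix (Fin (D1 i).v) (Fin (p i)) ℝ}
  {Ho2 : ∀ i, Matrix (Fin (D2 i).v) (Fin (p i)) ℝ}
  {Wo1 : ∀ i, Matrix (Fin (D1 i).v) (Fin (D1 i).v) ℝ}
  {Wo2 : ∀ i, Matrix (Fin (D2 i).v) (Fin (D2 i).v) ℝ} {γ : ℝ}

theorem mul_sub_gainH_mul (i : Fin N) :
    F.Q * (S.A - gainH F D1 D2 Ho1 Ho2 i * S.C i) * F.P =
      Matrix.fromBlocks (F.A11 - gainT D1 Ho1 i * F.C1 i) (F.A12 - gainT D1 Ho1 i * F.C2 i)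
        (F.A21 - gainT D2 Ho2 i * F.C1 i) (F.A22 - gainT D2 Ho2 i * F.C2 i) := by
  have h : F.Q * (gainH F D1 D2 Ho1 Ho2 i * S.C i) * F.P =
      Matrix.fromBlocks (gainT D1 Ho1 i * F.C1 i) (gainT D1 Ho1 i * F.C2 i)
        (gainT D2 Ho2 i * F.C1 i) (gainT D2 Ho2 i * F.C2 i) := by
    calc F.Q * (gainH F D1 D2 Ho1 Ho2 i * S.C i) * F.P
        = (F.Q * F.Q⁻¹) * Matrix.fromRows (gainT D1 Ho1 i) (gainT D2 Ho2 i) * (S.C i * F.P) := by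
          simp only [gainH, Matrix.mul_assoc]
      _ = _ := by
          rw [Matrix.mul_nonsing_inv _ ((Matrix.isUnit_iff_isUnit_det _).1 F.isUnit_Q),
            Matrix.one_mul, F.CP, Matrix.fromRows_mul_fromCols]
  rw [Matrix.mul_sub, Matrix.sub_mul, h, F.QAP, sub_eq_add_neg, Matrix.fromBlocks_neg,
    Matrix.fromBlocks_add]
  simp only [sub_eq_add_neg]

/-- The order `P · Q` in the weight is what makes `Q W⁻¹ P` block diagonal, so that the coupling
keeps the two parts separate. -/
theorem mul_weightW_inv_mul (h1 : LocalDesign D1 Ho1 Wo1 γ) (h2 : LocalDesign D2 Ho2 Wo2 γ)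
    (i : Fin N) : F.Q * (weightW F D1 D2 Wo1 Wo2 i)⁻¹ * F.P =
      Matrix.fromBlocks (weightT D1 Wo1 i)⁻¹ 0 0 (weightT D2 Wo2 i)⁻¹ := by
  have hZ : (Matrix.fromBlocks (weightT D1 Wo1 i) 0 0 (weightT D2 Wo2 i))⁻¹ =
      Matrix.fromBlocks (weightT D1 Wo1 i)⁻¹ 0 0 (weightT D2 Wo2 i)⁻¹ := by
    refine Matrix.inv_eq_right_inv ?_
    rw [Matrix.fromBlocks_multiply,
      Matrix.mul_nonsing_inv _ ((Matrix.isUnit_iff_isUnit_det _).1 (h1.isUnit_weightT i)),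
      Matrix.mul_nonsing_inv _ ((Matrix.isUnit_iff_isUnit_det _).1 (h2.isUnit_weightT i))]
    simp
  rw [weightW, Matrix.mul_inv_rev, Matrix.mul_inv_rev, hZ, ← Matrix.mul_assoc, ← Matrix.mul_assoc,
    Matrix.mul_nonsing_inv _ ((Matrix.isUnit_iff_isUnit_det _).1 F.isUnit_Q), Matrix.one_mul,
    Matrix.mul_assoc, Matrix.nonsing_inv_mul _ ((Matrix.isUnit_iff_isUnit_det _).1 F.isUnit_P),
    Matrix.mul_one]

theorem reindex_errorE (F : DDF S) :
    ((Matrix.blockDiagonal' fun _ => F.Q) * errorE S *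
      Matrix.blockDiagonal' fun _ : Fin N => F.P).reindex
      (Equiv.sigmaSumDistrib (fun _ : Fin N => Fin l) fun _ => Fin m)
      (Equiv.sigmaSumDistrib (fun _ : Fin N => Fin l) fun _ => Fin m) =
      Matrix.fromBlocks 1 0 0 0 := by
  rw [errorE, ← Matrix.blockDiagonal'_mul, ← Matrix.blockDiagonal'_mul, F.QEP,
    reindex_blockDiagonal'_fromBlocks]
  congr 1
  · exact Matrix.blockDiagonal'_one
  all_goals exact Matrix.blockDiagonal'_zero

theorem reindex_errorA (h1 : LocalDesign D1 Ho1 Wo1 γ) (h2 : LocalDesign D2 Ho2 Wo2 γ) :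
    ((Matrix.blockDiagonal' fun _ => F.Q) *
      errorA S G (gainH F D1 D2 Ho1 Ho2) (weightW F D1 D2 Wo1 Wo2) γ *
      Matrix.blockDiagonal' fun _ : Fin N => F.P).reindex
      (Equiv.sigmaSumDistrib (fun _ : Fin N => Fin l) fun _ => Fin m)
      (Equiv.sigmaSumDistrib (fun _ : Fin N => Fin l) fun _ => Fin m) =
      Matrix.fromBlocks (stateBlock G D1 Ho1 Wo1 γ)
        (Matrix.blockDiagonal' fun i => F.A12 - gainT D1 Ho1 i * F.C2 i)
        (Matrix.blockDiagonal' fun i => F.A21 - gainT D2 Ho2 i * F.C1 i)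
        (stateBlock G D2 Ho2 Wo2 γ) := by
  have h : (Matrix.blockDiagonal' fun _ => F.Q) *
      errorA S G (gainH F D1 D2 Ho1 Ho2) (weightW F D1 D2 Wo1 Wo2) γ *
      (Matrix.blockDiagonal' fun _ : Fin N => F.P) =
      (Matrix.blockDiagonal' fun i => F.Q * (S.A - gainH F D1 D2 Ho1 Ho2 i * S.C i) * F.P) -
      γ • ((Matrix.blockDiagonal' fun i => F.Q * (weightW F D1 D2 Wo1 Wo2 i)⁻¹ * F.P) *
        kronOne (lap G) (Fin l ⊕ Fin m)) := by
    -- All agents share the same `P`, so `diag {P, …, P}` commutes with the coupling in the sense of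
    -- `kronOne_mul_blockDiagonal'`.
    rw [errorA, Matrix.mul_sub, Matrix.sub_mul, Matrix.mul_smul, Matrix.smul_mul,
      Matrix.blockDiagonal'_mul, Matrix.blockDiagonal'_mul, Matrix.blockDiagonal'_mul,
      Matrix.blockDiagonal'_mul, Matrix.mul_assoc _ _ (kronOne _ _), ← kronOne_mul_blockDiagonal']
    simp only [Matrix.mul_assoc]
  rw [h]
  simp only [mul_sub_gainH_mul, mul_weightW_inv_mul h1 h2]
  rw [Matrix.reindex_apply, Matrix.submatrix_sub, Pi.sub_apply, Pi.sub_apply, Matrix.submatrix_smul,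
    Pi.smul_apply, Pi.smul_apply, ← Matrix.submatrix_mul_equiv _ _ _
      (Equiv.sigmaSumDistrib (fun _ : Fin N => Fin l) fun _ => Fin m).symm,
    ← Matrix.reindex_apply, ← Matrix.reindex_apply, ← Matrix.reindex_apply,
    reindex_blockDiagonal'_fromBlocks, reindex_blockDiagonal'_fromBlocks, reindex_kronOne,
    Matrix.fromBlocks_multiply, Matrix.fromBlocks_smul, sub_eq_add_neg, Matrix.fromBlocks_neg,
    Matrix.fromBlocks_add]
  have hz1 : (Matrix.blockDiagonal' fun _ : Fin N => (0 : Matrix (Fin l) (Fin m) ℝ)) = 0 :=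
    Matrix.blockDiagonal'_zero
  have hz2 : (Matrix.blockDiagonal' fun _ : Fin N => (0 : Matrix (Fin m) (Fin l) ℝ)) = 0 :=
    Matrix.blockDiagonal'_zero
  simp only [stateBlock, hz1, hz2, Matrix.mul_zero, Matrix.zero_mul, add_zero, zero_add, smul_zero,
    neg_zero, sub_eq_add_neg]

/-- The bound on `lambda1` inverts the algebraic block. The bound on `lambda2` makes `T₁ X₁₁ T₁ᵀ` a
Lyapunov matrix for the Schur complement. -/
theorem admissible_errorDynamics {r : Fin N → ℝ} (hr : IsLeftVector G r) {μ : ℝ}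
    (hμ1 : JointBound G r D1 μ) (hμ2 : JointBound G r D2 μ) (hγ : 0 < γ)
    (h1 : LocalDesign D1 Ho1 Wo1 γ) (h2 : LocalDesign D2 Ho2 Wo2 γ)
    (hlam1 : lambda1 F r D2 < γ * μ)
    (hlam2 : lambda2 F G r D1 D2 Ho1 Ho2 Wo1 Wo2 γ < γ * μ) :
    Admissible (errorE S)
      (errorA S G (gainH F D1 D2 Ho1 Ho2) (weightW F D1 D2 Wo1 Wo2) γ) := by
  have hu : IsUnit (errorBlock G D2 Ho2 Wo2 γ) := h2.isUnit_errorBlock hr hγ hμ2 hlam1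
  have hud := (Matrix.isUnit_iff_isUnit_det _).1 hu
  have hinv : stateBlock G D2 Ho2 Wo2 γ *
      (bigT D2 * (errorBlock G D2 Ho2 Wo2 γ)⁻¹ * (bigT D2)ᵀ) = 1 := by
    rw [h2.stateBlock_eq]
    calc bigT D2 * errorBlock G D2 Ho2 Wo2 γ * (bigT D2)ᵀ *
          (bigT D2 * (errorBlock G D2 Ho2 Wo2 γ)⁻¹ * (bigT D2)ᵀ)
        = bigT D2 * (errorBlock G D2 Ho2 Wo2 γ * ((bigT D2)ᵀ * bigT D2) *
          (errorBlock G D2 Ho2 Wo2 γ)⁻¹) * (bigT D2)ᵀ := by simp only [Matrix.mul_assoc]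
      _ = 1 := by
        rw [bigT_transpose_mul_self, Matrix.mul_one, Matrix.mul_nonsing_inv _ hud, Matrix.mul_one,
          bigT_mul_transpose_self]
  have hunit := IsUnit.of_mul_eq_one _ hinv
  have hQ : IsUnit (Matrix.blockDiagonal' fun _ : Fin N => F.Q) :=
    isUnit_blockDiagonal' fun _ => F.isUnit_Q
  have hP : IsUnit (Matrix.blockDiagonal' fun _ : Fin N => F.P) :=
    isUnit_blockDiagonal' fun _ => F.isUnit_P
  refine ⟨impulseFree_of_decomposition hQ hP (reindex_errorE F) (reindex_errorA h1 h2) hunit,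
    fun z hz => ?_⟩
  set K := X11 F r D1 Wo1 * Lam12 F D1 D2 Ho1 * (Lam22 F G D2 Ho2 Wo2 γ)⁻¹ *
    Lam21 F D1 D2 Ho2 with hK
  have hpd := h1.posDef_neg_sym hr hγ hμ1 hlam2 (K := K) fun y => by
    refine form_le_eigMax ?_ y
    simp only [Matrix.transpose_sub, Matrix.transpose_add, Matrix.transpose_transpose]
    abel
  have hX := h1.posDef_lyapMatrix hr.pos
  -- In state coordinates, Lyapunov matrix times Schur complement is the conjugate by `T₁` of `X *
  -- errorBlock - K`.
  have hYM : bigT D1 * lyapMatrix r D1 Wo1 * (bigT D1)ᵀ * (stateBlock G D1 Ho1 Wo1 γ -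
      (Matrix.blockDiagonal' fun i => F.A12 - gainT D1 Ho1 i * F.C2 i) *
        (stateBlock G D2 Ho2 Wo2 γ)⁻¹ *
        Matrix.blockDiagonal' fun i => F.A21 - gainT D2 Ho2 i * F.C1 i) =
      bigT D1 * (lyapMatrix r D1 Wo1 * errorBlock G D1 Ho1 Wo1 γ - K) * (bigT D1)ᵀ := by
    rw [Matrix.inv_eq_right_inv hinv, h1.errorBlock_eq, hK]
    -- `X11` and `Lam22` are by definition instances of `lyapMatrix` and `errorBlock`.
    change _ = bigT D1 * (lyapMatrix r D1 Wo1 * _ - lyapMatrix r D1 Wo1 * _ *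
      (errorBlock G D2 Ho2 Wo2 γ)⁻¹ * _) * _
    simp only [Lam12, Lam21, Matrix.mul_sub, Matrix.sub_mul, Matrix.mul_assoc,
      bigT_mul_transpose_self, Matrix.mul_one]
  have hinj : Function.Injective (bigT D1)ᵀ.mulVec := fun x y hxy => by
    have := congrArg (bigT D1 *ᵥ ·) hxy
    simpa [Matrix.mulVec_mulVec, bigT_mul_transpose_self] using this
  have hconj : ∀ {M : Matrix (Σ i, Fin (D1 i).v ⊕ Fin (D1 i).u)
      (Σ i, Fin (D1 i).v ⊕ Fin (D1 i).u) ℝ}, M.PosDef →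
      (bigT D1 * M * (bigT D1)ᵀ).PosDef := fun {M} hM => by
    have := hM.conjTranspose_mul_mul_same (B := (bigT D1)ᵀ) hinj
    simpa using this
  refine tendsto_zero_of_decomposition hP (reindex_errorE F) (reindex_errorA h1 h2) hunit
    (hconj hX) ?_ hz
  rw [hYM]
  convert hconj hpd using 1
  simp only [Matrix.mul_neg, Matrix.neg_mul, Matrix.mul_add, Matrix.add_mul, Matrix.transpose_mul,
    Matrix.transpose_transpose, Matrix.mul_assoc]

/-- The true state cancels in every difference `x̂ⱼ - x̂ᵢ`, so the coupling acts on the error as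
minus the Laplacian. -/
theorem isTrajectory_error {H : ∀ i, Matrix (Fin l ⊕ Fin m) (Fin (p i)) ℝ}
    {W : Fin N → Matrix (Fin l ⊕ Fin m) (Fin l ⊕ Fin m) ℝ}
    {x : ℝ → Fin l ⊕ Fin m → ℝ} {xhat : Fin N → ℝ → Fin l ⊕ Fin m → ℝ}
    (hx : IsTrajectory S.E S.A x) (hxhat : IsObserverTrajectory S G H W γ x xhat) :
    IsTrajectory (errorE S) (errorA S G H W γ)
      fun t (a : Σ _ : Fin N, Fin l ⊕ Fin m) => xhat a.1 t a.2 - x t a.2 := by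
  intro t ht
  rw [hasDerivAt_pi]
  rintro ⟨i, c⟩
  have h := (hasDerivAt_pi.1 ((hxhat i t ht).sub (hx t ht))) c
  have hL : (fun s => (errorE S *ᵥ fun a : Σ _ : Fin N, Fin l ⊕ Fin m =>
      xhat a.1 s a.2 - x s a.2) ⟨i, c⟩) =
      fun s => ((fun s => S.E *ᵥ xhat i s) - fun s => S.E *ᵥ x s) s c := by
    funext s
    rw [errorE, blockDiagonal'_mulVec_apply]
    change (S.E *ᵥ (xhat i s - x s)) c = _
    rw [Matrix.mulVec_sub]
    rfl
  rw [hL]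
  refine h.congr_deriv ?_
  have hlap : (fun b => (kronOne (lap G) (Fin l ⊕ Fin m) *ᵥ fun a => xhat a.1 t a.2 - x t a.2)
      ⟨i, b⟩) = -∑ j, adj G i j • (xhat j t - xhat i t) := by
    funext b
    rw [kronOne_mulVec_apply, lap_mulVec_apply, Pi.neg_apply, Finset.sum_apply,
      ← Finset.sum_neg_distrib]
    refine Finset.sum_congr rfl fun j _ => ?_
    simp only [Pi.smul_apply, Pi.sub_apply, smul_eq_mul]
    ring
  have hR : (errorA S G H W γ *ᵥ fun a : Σ _ : Fin N, Fin l ⊕ Fin m =>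
      xhat a.1 t a.2 - x t a.2) ⟨i, c⟩ = ((S.A - H i * S.C i) *ᵥ (xhat i t - x t)) c -
      γ * ((W i)⁻¹ *ᵥ -∑ j, adj G i j • (xhat j t - xhat i t)) c := by
    rw [errorA, Matrix.sub_mulVec, Matrix.smul_mulVec, ← Matrix.mulVec_mulVec, Pi.sub_apply,
      Pi.smul_apply, blockDiagonal'_mulVec_apply, blockDiagonal'_mulVec_apply, hlap]
    rfl
  rw [hR, Matrix.sub_mulVec, Matrix.mulVec_neg, ← Matrix.mulVec_mulVec, Matrix.mulVec_sub,
    Matrix.mulVec_sub, Matrix.mulVec_sub, Matrix.mulVec_sub]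
  simp only [Pi.sub_apply, Pi.add_apply, Pi.smul_apply, Pi.neg_apply, smul_eq_mul]
  ring

theorem omniscience_of_admissible {H : ∀ i, Matrix (Fin l ⊕ Fin m) (Fin (p i)) ℝ}
    {W : Fin N → Matrix (Fin l ⊕ Fin m) (Fin l ⊕ Fin m) ℝ}
    (h : Admissible (errorE S) (errorA S G H W γ)) : Omniscience S G H W γ := by
  intro x xhat hx hxhat i
  have ht := tendsto_pi_nhds.1 (h.tendsto_zero _ (isTrajectory_error hx hxhat))
  have : Tendsto (fun t => xhat i t - x t) atTop (𝓝 0) :=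
    tendsto_pi_nhds.2 fun c => ht ⟨i, c⟩
  simpa using this.norm

end Observer

end DistObs

/-! ### Assembly of the main theorem. -/

theorem theorem2 {N l m : ℕ} {p : Fin N → ℕ}
    (S : DistObs.DescriptorSystem N l m p) (G : Digraph (Fin N))
    (hG : DistObs.StronglyConnected G)
    (F : DistObs.DDF S)
    (hobs1 : DistObs.IsObservablePair (DistObs.stackRows F.C1) F.A11)
    (hobs2 : DistObs.IsObservablePair (DistObs.stackRows F.C2) F.A22)
    (D1 : ∀ i, DistObs.ObsDecomp (F.C1 i) F.A11)
    (D2 : ∀ i, DistObs.ObsDecomp (F.C2 i) F.A22) :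
    (∃ r : Fin N → ℝ, DistObs.IsLeftVector G r) ∧
    ∀ r : Fin N → ℝ, DistObs.IsLeftVector G r →
      (∃ μ : ℝ, 0 < μ ∧ DistObs.JointBound G r D1 μ ∧ DistObs.JointBound G r D2 μ) ∧
      ∀ μ : ℝ, 0 < μ → DistObs.JointBound G r D1 μ → DistObs.JointBound G r D2 μ →
      ∀ (γ : ℝ)
        (Ho1 : ∀ i, Matrix (Fin (D1 i).v) (Fin (p i)) ℝ)
        (Ho2 : ∀ i, Matrix (Fin (D2 i).v) (Fin (p i)) ℝ)
        (Wo1 : ∀ i, Matrix (Fin (D1 i).v) (Fin (D1 i).v) ℝ)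
        (Wo2 : ∀ i, Matrix (Fin (D2 i).v) (Fin (D2 i).v) ℝ),
        0 < γ →
        DistObs.LocalDesign D1 Ho1 Wo1 γ →
        DistObs.LocalDesign D2 Ho2 Wo2 γ →
        1 / μ * max (DistObs.lambda1 F r D2)
          (DistObs.lambda2 F G r D1 D2 Ho1 Ho2 Wo1 Wo2 γ) < γ →
        DistObs.Omniscience S G (DistObs.gainH F D1 D2 Ho1 Ho2)
          (DistObs.weightW F D1 D2 Wo1 Wo2) γ ∧
        DistObs.Admissible (DistObs.errorE S)
          (DistObs.errorA S G (DistObs.gainH F D1 D2 Ho1 Ho2)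
            (DistObs.weightW F D1 D2 Wo1 Wo2) γ) := by
  refine ⟨DistObs.exists_isLeftVector hG, fun r hr => ⟨?_, ?_⟩⟩
  · obtain ⟨μ₁, hpos₁, h₁⟩ := DistObs.exists_jointBound hG hr hobs1 D1
    obtain ⟨μ₂, hpos₂, h₂⟩ := DistObs.exists_jointBound hG hr hobs2 D2
    exact ⟨min μ₁ μ₂, lt_min hpos₁ hpos₂, h₁.mono (min_le_left _ _), h₂.mono (min_le_right _ _)⟩
  · intro μ hμ hμ1 hμ2 γ Ho1 Ho2 Wo1 Wo2 hγ h1 h2 hlam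
    rw [one_div, inv_mul_lt_iff₀ hμ, mul_comm μ, max_lt_iff] at hlam
    have hadm := DistObs.admissible_errorDynamics hr hμ1 hμ2 hγ h1 h2 hlam.1 hlam.2
    exact ⟨DistObs.omniscience_of_admissible hadm, hadm⟩
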